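/- Let $I=[0,1]$ and let a buyer have independent values $x_1,x_2\in I$ for two items, with densities $f_1,f_2:I\to(0,\infty)$ that are absolutely continuous and positive on $I$, and cdfs $F_1,F_2$. Put $$h(x_1,x_2)=3f_1(x_1)f_2(x_2)+x_1f_1'(x_1)f_2(x_2)+x_2f_2'(x_2)f_1(x_1),$$ and assume that $h(x_1,x_2)-f_2(1)f_1(x_1)$ and $h(x_1,x_2)-f_1(1)f_2(x_2)$ are nonnegative on $I^2$ and that $h$ is absolutely continuous in each of its coordinates. A (direct-revelation) mechanism consists of allocation probabilities $a_1,a_2:I^2\to I$ and a payment $t:I^2\to[0,\infty)$ such that, for all $x,b\in I^2$, $a_1(b)x_1+a_2(b)x_2-t(b)\le u(x):=a_1(x)x_1+a_2(x)x_2-t(x)$ (incentive compatibility) and $u(x)\ge 0$ (individual rationality); $u$ is its utility function, and it is optimal if its expected payment $\int_{I^2}t(x)f_1(x_1)f_2(x_2)\,dx$ is maximal among all mechanisms. A feasible utility function is a continuous convex function $u:I^2\to[0,\infty)$ whose partial derivatives lie in $[0,1]$ almost everywhere, and $$\mathcal R(u)=\int_0^1\!\!\int_0^1\Big(x_1\frac{\partial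 u}{\partial x_1}+x_2\frac{\partial u}{\partial x_2}-u(x)\Big)f_1(x_1)f_2(x_2)\,dx_1\,dx_2 .$$ Suppose there are (weakly) decreasing, concave functions $s_1,s_2:I\to I$, differentiable on $I$ (one-sidedly at the end points) with $s_1'(t),s_2'(t)>-1$ for all $t\in I$, such that for almost every $x_1,x_2\in I$ the following quotients are well defined (that is, $F_1(s_1(x_2))<1$ and $F_2(s_2(x_1))<1$) and $$\frac{s_1(x_2)f_1(s_1(x_2))}{1-F_1(s_1(x_2))}=2+\frac{x_2f_2'(x_2)}{f_2(x_2)},\qquad \frac{s_2(x_1)f_2(s_2(x_1))}{1-F_2(s_2(x_1))}=2+\frac{x_1f_1'(x_1)}{f_1(x_1)} .$$ Then there is a $p\in[0,2]$ such that $$\int_D h(x)\,dx=f_1(1)+f_2(1),\qquad D=\{x\in I^2:\ x_1+x_2\ge p\ \text{ or }\ x_1\ge s_1(x_2)\ \text{ or }\ x_2\ge s_2(x_1)\},$$ and such that the optimal mechanism is given by the utility function $$u(x)=\max\{0,\ x_1-s_1(x_2),\ x_2-s_2(x_1),\ x_1+x_2-p\}:$$ $u$ is a feasible utility function that maximizes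 $\mathcal R$ over all feasible utility functions, $u$ is the utility function of some mechanism, and every mechanism with utility function $u$ is optimal. In particular, if $p\le\min\{s_1(0),s_2(0)\}$, then deterministic full bundling at price $p$ is optimal: selling both items together at price $p$ exactly when $x_1+x_2\ge p$ (utility function $\max\{0,x_1+x_2-p\}$) is an optimal mechanism, and its utility function maximizes $\mathcal R$ over all feasible utility functions. -/

import Mathlib

open Set MeasureTheory

noncomputable section

namespace TwoGood

/-- The unit interval, as a set of reals. -/
def unitI : Set ℝ := Icc 0 1

/-- The valuation space, the unit square. -/
def square : Set (ℝ × ℝ) := unitI ×ˢ unitI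

/-- An absolutely continuous, positive probability density on the unit interval.
Values outside the interval are irrelevant. -/
structure IsDensity (f : ℝ → ℝ) : Prop where
  absCont : AbsolutelyContinuousOnInterval f 0 1
  pos : ∀ t ∈ unitI, 0 < f t
  integral_eq_one : ∫ t in (0 : ℝ)..1, f t = 1

/-- The cumulative distribution function of a density on the unit interval. -/
def cdfOf (f : ℝ → ℝ) (t : ℝ) : ℝ := ∫ y in (0 : ℝ)..t, f y

/-- The derivative of `f` as a function on the unit interval (one-sided at the end points). -/
def dens' (f : ℝ → ℝ) (t : ℝ) : ℝ := derivWithin f unitI t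

/-- `h(x) = 3 f₁(x₁) f₂(x₂) + x₁ f₁'(x₁) f₂(x₂) + x₂ f₂'(x₂) f₁(x₁)`. -/
def hFun (f₁ f₂ : ℝ → ℝ) (x : ℝ × ℝ) : ℝ :=
  3 * f₁ x.1 * f₂ x.2 + x.1 * dens' f₁ x.1 * f₂ x.2 + x.2 * dens' f₂ x.2 * f₁ x.1

/-- The regularity assumption on the pair of densities. -/
structure IsRegular (f₁ f₂ : ℝ → ℝ) : Prop where
  nonneg₁ : ∀ x ∈ square, 0 ≤ hFun f₁ f₂ x - f₂ 1 * f₁ x.1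
  nonneg₂ : ∀ x ∈ square, 0 ≤ hFun f₁ f₂ x - f₁ 1 * f₂ x.2
  absCont₁ : ∀ x₂ ∈ unitI, AbsolutelyContinuousOnInterval (fun t => hFun f₁ f₂ (t, x₂)) 0 1
  absCont₂ : ∀ x₁ ∈ unitI, AbsolutelyContinuousOnInterval (fun t => hFun f₁ f₂ (x₁, t)) 0 1

/-- A (weakly) decreasing, concave function from the unit interval to itself, differentiable with
derivative above `-1` at every point (one-sided at the end points). -/
structure IsSlopeCurve (s : ℝ → ℝ) : Prop where
  mapsTo : MapsTo s unitI unitI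
  antitone : AntitoneOn s unitI
  concave : ConcaveOn ℝ unitI s
  slope : ∀ t ∈ unitI, ∃ d : ℝ, -1 < d ∧ HasDerivWithinAt s d unitI t

/-- `s(t) f(s(t)) / (1 - F(s(t))) = 2 + t g'(t) / g(t)` for almost every `t` in the unit interval,
where `F` is the cdf of `f`; the left-hand side is required to be well defined. -/
def SolvesSlice (f g s : ℝ → ℝ) : Prop :=
  ∀ᵐ t ∂(volume.restrict unitI),
    cdfOf f (s t) < 1 ∧
      s t * f (s t) / (1 - cdfOf f (s t)) = 2 + t * dens' g t / g t

/-- The region `D` of valuations at which something is sold. -/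
def region (s₁ s₂ : ℝ → ℝ) (p : ℝ) : Set (ℝ × ℝ) :=
  {x | x ∈ square ∧ (p ≤ x.1 + x.2 ∨ s₁ x.2 ≤ x.1 ∨ s₂ x.1 ≤ x.2)}

/-- `u(x) = max {0, x₁ - s₁(x₂), x₂ - s₂(x₁), x₁ + x₂ - p}`. -/
def optUtility (s₁ s₂ : ℝ → ℝ) (p : ℝ) (x : ℝ × ℝ) : ℝ :=
  max 0 (max (x.1 - s₁ x.2) (max (x.2 - s₂ x.1) (x.1 + x.2 - p)))

/-- Partial derivative in the first coordinate. -/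
def partial₁ (u : ℝ × ℝ → ℝ) (x : ℝ × ℝ) : ℝ := deriv (fun t => u (t, x.2)) x.1

/-- Partial derivative in the second coordinate. -/
def partial₂ (u : ℝ × ℝ → ℝ) (x : ℝ × ℝ) : ℝ := deriv (fun t => u (x.1, t)) x.2

/-- The revenue functional on utility functions. -/
def revenueOf (f₁ f₂ : ℝ → ℝ) (u : ℝ × ℝ → ℝ) : ℝ :=
  ∫ x in square, (partial₁ u x * x.1 + partial₂ u x * x.2 - u x) * f₁ x.1 * f₂ x.2

/-- A feasible utility function: nonnegative, continuous and convex on the unit square, with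
partial derivatives in `[0, 1]` almost everywhere (the partial derivatives of a convex function
exist almost everywhere). -/
structure IsFeasibleUtility (u : ℝ × ℝ → ℝ) : Prop where
  nonneg : ∀ x ∈ square, 0 ≤ u x
  continuousOn : ContinuousOn u square
  convexOn : ConvexOn ℝ square u
  partials : ∀ᵐ x ∂(volume.restrict square), partial₁ u x ∈ Icc (0 : ℝ) 1 ∧
    partial₂ u x ∈ Icc (0 : ℝ) 1

/-- `u` attains the supremum of the revenue functional over all feasible utility functions. -/
def IsOptimalUtility (f₁ f₂ : ℝ → ℝ) (u : ℝ × ℝ → ℝ) : Prop :=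
  IsFeasibleUtility u ∧ ∀ v : ℝ × ℝ → ℝ, IsFeasibleUtility v →
    revenueOf f₁ f₂ v ≤ revenueOf f₁ f₂ u

/-- The data of a direct-revelation mechanism: for each bid pair, the probability with which each
item is sold, and the expected payment. Only the values on the unit square matter. -/
structure Mechanism where
  alloc₁ : ℝ × ℝ → ℝ
  alloc₂ : ℝ × ℝ → ℝ
  pay : ℝ × ℝ → ℝ

namespace Mechanism

/-- The utility of a buyer with values `x` who bids `b`. -/
def utility (M : Mechanism) (b x : ℝ × ℝ) : ℝ :=
  M.alloc₁ b * x.1 + M.alloc₂ b * x.2 - M.pay b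

/-- Allocation probabilities lie in `[0, 1]`, payments are nonnegative, and the mechanism is
incentive compatible and individually rational. -/
structure IsAdmissible (M : Mechanism) : Prop where
  alloc₁_mem : ∀ b ∈ square, M.alloc₁ b ∈ unitI
  alloc₂_mem : ∀ b ∈ square, M.alloc₂ b ∈ unitI
  pay_nonneg : ∀ b ∈ square, 0 ≤ M.pay b
  incentiveCompatible : ∀ x ∈ square, ∀ b ∈ square, M.utility b x ≤ M.utility x x
  individuallyRational : ∀ x ∈ square, 0 ≤ M.utility x x

/-- The admissible mechanism `M` gives the truthful buyer the utility function `u`. -/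
def Induces (u : ℝ × ℝ → ℝ) (M : Mechanism) : Prop :=
  M.IsAdmissible ∧ ∀ x ∈ square, M.utility x x = u x

/-- The expected payment under truthful bidding, for independent values with densities
`f₁`, `f₂`. -/
def expectedRevenue (f₁ f₂ : ℝ → ℝ) (M : Mechanism) : ℝ :=
  ∫ x in square, M.pay x * f₁ x.1 * f₂ x.2

/-- `M` has the largest expected revenue among all admissible mechanisms. -/
def IsOptimal (f₁ f₂ : ℝ → ℝ) (M : Mechanism) : Prop :=
  M.IsAdmissible ∧ ∀ N : Mechanism, N.IsAdmissible →
    N.expectedRevenue f₁ f₂ ≤ M.expectedRevenue f₁ f₂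

open Classical in
/-- Deterministic full bundling: both items are sold together at price `p` exactly to the buyers
whose total value is at least `p`, and nothing is sold otherwise. -/
def fullBundling (p : ℝ) : Mechanism where
  alloc₁ x := if p ≤ x.1 + x.2 then 1 else 0
  alloc₂ x := if p ≤ x.1 + x.2 then 1 else 0
  pay x := if p ≤ x.1 + x.2 then p else 0

end Mechanism

end TwoGood

end

/-! ### The interval, the square, and the main idea -/

namespace TwoGood

/-! Integration by parts turns the revenue of `v` into `dualRevenue`: the integral of `v` over the
right edge with density `f₁(1) f₂`, plus that over the top edge with density `f₂(1) f₁`, minus the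
integral of `v h` over the square. This is linear in the values of `v`, and since `h ≥ 0` the
problem becomes one of matching the mass `h` with the edge masses, where `v ≥ 0` has slopes in `[0,
1]` in each coordinate.

The slice equation for `s₁` says that on almost every horizontal line the `h`-mass to the right of
the curve equals the right-edge density at that height (`ae_integral_slice`); the same holds
vertically for `s₂`. The region `D` splits at a corner `(c₁, c₂)`. Below height `c₂` the mass is
matched horizontally, and `v(1, x₂) - v(x) ≤ 1 - x₁`; to the left of `c₁` it is matched vertically.
Outside `D` the term `-v h` is at most zero. In the central part `h` carries as much mass as the
remaining pieces of the edges, by the choice of `p`. There `x₁ + x₂ - v(x)`, up to a constant, is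
nonnegative and nondecreasing, and the edge measures dominate `h` stochastically
(`integral_cornerRegion_le`), so `v` does no better than `x₁ + x₂ - p`. The dominance reduces to
corner-shaped sets, where strips of known mass are cut off (`inner_cornerRegion_le`). All these
bounds are equalities for `optUtility`, which vanishes off `D`, has slope one along the matching
lines, and equals `x₁ + x₂ - p` in the central part.

The price `p` comes from the intermediate value theorem (`exists_balanced_price`). For mechanisms,
incentive compatibility says that the allocation is a field of subgradients of the utility. Hence
the utility is feasible, its gradient is the allocation almost everywhere, and expected payment
equals the revenue functional; conversely, a subgradient field of `optUtility` defines a mechanism.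
-/

lemma mem_square {x : ℝ × ℝ} : x ∈ square ↔ (0 ≤ x.1 ∧ x.1 ≤ 1) ∧ 0 ≤ x.2 ∧ x.2 ≤ 1 := Iff.rfl

lemma zero_mem_unitI : (0 : ℝ) ∈ unitI := ⟨le_rfl, zero_le_one⟩

lemma one_mem_unitI : (1 : ℝ) ∈ unitI := ⟨zero_le_one, le_rfl⟩

lemma measurableSet_unitI : MeasurableSet unitI := measurableSet_Icc

lemma isCompact_unitI : IsCompact unitI := isCompact_Icc

lemma isCompact_square : IsCompact square := isCompact_unitI.prod isCompact_unitI

lemma isClosed_square : IsClosed square := isCompact_square.isClosed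

lemma measurableSet_square : MeasurableSet square := measurableSet_unitI.prod measurableSet_unitI

lemma convex_unitI : Convex ℝ unitI := convex_Icc 0 1

lemma convex_square : Convex ℝ square := convex_unitI.prod convex_unitI

lemma uIcc_zero_one : uIcc (0 : ℝ) 1 = unitI := uIcc_of_le zero_le_one

/-- Lebesgue measure on the square is the product of Lebesgue measures on the intervals. -/
lemma volume_restrict_square :
    (volume : Measure (ℝ × ℝ)).restrict square =
      (volume.restrict unitI).prod (volume.restrict unitI) := by
  rw [Measure.prod_restrict]; rfl

lemma intervalIntegral_eq_setIntegral_unitI (g : ℝ → ℝ) :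
    ∫ t in (0 : ℝ)..1, g t = ∫ t in unitI, g t := by
  rw [intervalIntegral.integral_of_le zero_le_one, ← integral_Icc_eq_integral_Ioc]; rfl

lemma intervalIntegrable_iff_integrableOn_unitI {g : ℝ → ℝ} :
    IntervalIntegrable g volume 0 1 ↔ IntegrableOn g unitI := by
  rw [intervalIntegrable_iff_integrableOn_Icc_of_le zero_le_one]; rfl

lemma ae_mem_Ioo : ∀ᵐ t ∂(volume.restrict unitI), t ∈ Ioo (0 : ℝ) 1 := by
  have : volume.restrict unitI = volume.restrict (Ioo (0 : ℝ) 1) :=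
    (Measure.restrict_congr_set Ioo_ae_eq_Icc).symm
  rw [this]
  exact ae_restrict_mem measurableSet_Ioo

lemma dens'_eq_deriv {f : ℝ → ℝ} {t : ℝ} (ht : t ∈ Ioo (0 : ℝ) 1) : dens' f t = deriv f t :=
  derivWithin_of_mem_nhds (Icc_mem_nhds ht.1 ht.2)

/-- The derivative of `t ↦ t f(t)`. -/
noncomputable def momentDeriv (f : ℝ → ℝ) (t : ℝ) : ℝ := f t + t * dens' f t

lemma hFun_eq (f₁ f₂ : ℝ → ℝ) (x : ℝ × ℝ) :
    hFun f₁ f₂ x = momentDeriv f₁ x.1 * f₂ x.2 + f₁ x.1 * momentDeriv f₂ x.2 + f₁ x.1 * f₂ x.2 := by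
  simp only [hFun, momentDeriv]; ring

lemma hFun_swap (f₁ f₂ : ℝ → ℝ) (x : ℝ × ℝ) : hFun f₂ f₁ x.swap = hFun f₁ f₂ x := by
  simp only [hFun, Prod.fst_swap, Prod.snd_swap]; ring

/-! ### Densities and integration by parts against `t f(t)` -/

namespace IsDensity

variable {f : ℝ → ℝ}

lemma continuousOn (hf : IsDensity f) : ContinuousOn f unitI := by
  rw [← uIcc_zero_one]; exact hf.absCont.continuousOn

lemma integrableOn (hf : IsDensity f) : IntegrableOn f unitI :=
  hf.continuousOn.integrableOn_compact isCompact_unitI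

lemma absCont_moment (hf : IsDensity f) :
    AbsolutelyContinuousOnInterval (fun t => t * f t) 0 1 := by
  have hid : AbsolutelyContinuousOnInterval (fun t : ℝ => t) 0 1 :=
    (LipschitzWith.id.lipschitzOnWith (s := uIcc (0 : ℝ) 1)).absolutelyContinuousOnInterval
  exact hid.fun_mul hf.absCont

/-- Absolute continuity gives differentiability almost everywhere, and off the end points the
one-sided `dens'` is the ordinary derivative. -/
lemma ae_deriv_moment (hf : IsDensity f) :
    ∀ᵐ t ∂(volume.restrict unitI), deriv (fun t => t * f t) t = momentDeriv f t := by
  have h := hf.absCont.ae_differentiableAt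
  rw [uIcc_zero_one] at h
  filter_upwards [ae_restrict_of_ae h, ae_mem_Ioo] with t h1 h2
  have h3 := (hasDerivAt_id t).mul (h1 (Ioo_subset_Icc_self h2)).hasDerivAt
  have h4 : deriv (fun t => t * f t) t = 1 * f t + t * deriv f t := h3.deriv
  rw [h4, momentDeriv, dens'_eq_deriv h2, one_mul]

lemma integrableOn_momentDeriv (hf : IsDensity f) : IntegrableOn (momentDeriv f) unitI :=
  (intervalIntegrable_iff_integrableOn_unitI.1 hf.absCont_moment.intervalIntegrable_deriv).congr
    hf.ae_deriv_moment

lemma integral_momentDeriv (hf : IsDensity f) {a : ℝ} (ha : a ∈ unitI) :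
    ∫ t in a..1, momentDeriv f t = f 1 - a * f a := by
  have hsub : uIcc a 1 ⊆ unitI := by rw [uIcc_of_le ha.2]; exact Icc_subset_Icc_left ha.1
  have h := (hf.absCont_moment.mono (c := a) (d := 1)
    (by rwa [uIcc_zero_one])).integral_deriv_eq_sub
  have h2 : ∫ t in a..1, momentDeriv f t = ∫ t in a..1, deriv (fun t => t * f t) t := by
    apply intervalIntegral.integral_congr_ae
    have := (ae_restrict_iff' measurableSet_unitI).1 hf.ae_deriv_moment
    filter_upwards [this] with t ht htm
    exact (ht (hsub (uIoc_subset_uIcc htm))).symm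
  rw [h2, h, one_mul]

/-- The factor `t` removes the boundary term at 0, so only the edge value at 1 survives. -/
lemma integral_deriv_mul_moment (hf : IsDensity f) {g : ℝ → ℝ}
    (hg : AbsolutelyContinuousOnInterval g 0 1) :
    ∫ t in unitI, deriv g t * (t * f t) = g 1 * f 1 - ∫ t in unitI, g t * momentDeriv f t := by
  have h := hf.absCont_moment.integral_mul_deriv_eq_deriv_mul hg
  rw [intervalIntegral_eq_setIntegral_unitI, intervalIntegral_eq_setIntegral_unitI] at h
  have h1 : ∫ t in unitI, deriv (fun t => t * f t) t * g t = ∫ t in unitI, g t * momentDeriv f t := by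
    apply integral_congr_ae
    filter_upwards [hf.ae_deriv_moment] with t ht
    rw [ht, mul_comm]
  rw [h1] at h
  simp only [one_mul, zero_mul, sub_zero] at h
  rw [mul_comm (g 1), ← h]
  exact integral_congr_ae (Filter.Eventually.of_forall fun t => mul_comm _ _)

lemma setIntegral_eq_one (hf : IsDensity f) : ∫ t in unitI, f t = 1 := by
  rw [← intervalIntegral_eq_setIntegral_unitI, hf.integral_eq_one]

lemma integral_tail (hf : IsDensity f) {a : ℝ} (ha : a ∈ unitI) :
    ∫ t in a..1, f t = 1 - cdfOf f a := by
  have hi := intervalIntegrable_iff_integrableOn_unitI.2 hf.integrableOn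
  have h := intervalIntegral.integral_add_adjacent_intervals (a := 0) (b := a) (c := 1) (f := f)
    (μ := volume) (hi.mono_set (by rw [uIcc_zero_one, uIcc_of_le ha.1]; exact Icc_subset_Icc_right ha.2))
    (hi.mono_set (by rw [uIcc_zero_one, uIcc_of_le ha.2]; exact Icc_subset_Icc_left ha.1))
  rw [hf.integral_eq_one] at h
  rw [cdfOf]; linarith

end IsDensity

/-! ### The mass `h`, the edge masses, and the slice equations as projections -/

/-- The mass of `h` on a slice, beyond the point prescribed by `SolvesSlice`. -/
lemma ae_integral_slice {f g s : ℝ → ℝ} (hf : IsDensity f) (hg : IsDensity g)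
    (hs : MapsTo s unitI unitI) (h : SolvesSlice f g s) :
    ∀ᵐ y ∂(volume.restrict unitI), ∫ x in s y..1, hFun f g (x, y) = f 1 * g y := by
  filter_upwards [h, ae_restrict_mem measurableSet_unitI] with y hy hyI
  obtain ⟨h1, h2⟩ := hy
  have hsy := hs hyI
  have hsub : uIcc (s y) 1 ⊆ uIcc 0 1 := by
    rw [uIcc_of_le hsy.2, uIcc_zero_one]; exact Icc_subset_Icc_left hsy.1
  have hi := (intervalIntegrable_iff_integrableOn_unitI.2 hf.integrableOn).mono_set hsub
  have hi' := (intervalIntegrable_iff_integrableOn_unitI.2 hf.integrableOn_momentDeriv).mono_set hsub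
  have hgy := hg.pos y hyI
  have h3 : 0 < 1 - cdfOf f (s y) := by linarith
  simp only [hFun_eq]
  rw [intervalIntegral.integral_add, intervalIntegral.integral_add,
    intervalIntegral.integral_mul_const, intervalIntegral.integral_mul_const,
    intervalIntegral.integral_mul_const, hf.integral_momentDeriv hsy, hf.integral_tail hsy,
    momentDeriv]
  -- The slice integral is `g(y) (f(1) - s f(s)) + (2 g(y) + y g'(y)) (1 - F(s))` with `s = s(y)`;
  -- the slice equation cancels everything but `f(1) g(y)`.
  · rw [div_eq_iff h3.ne'] at h2
    have h4 : s y * f (s y) * g y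
        = (2 * g y + y * dens' g y) * (1 - cdfOf f (s y)) := by
      rw [h2]; field_simp
    linear_combination -h4
  · exact hi'.mul_const _
  · exact hi.mul_const _
  · exact (hi'.mul_const _).add (hi.mul_const _)
  · exact hi.mul_const _

lemma integrableOn_hFun {f₁ f₂ : ℝ → ℝ} (hf₁ : IsDensity f₁) (hf₂ : IsDensity f₂) :
    IntegrableOn (hFun f₁ f₂) square := by
  rw [IntegrableOn, volume_restrict_square]
  have h := ((hf₁.integrableOn_momentDeriv.mul_prod hf₂.integrableOn).add
    (hf₁.integrableOn.mul_prod hf₂.integrableOn_momentDeriv)).add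
    (hf₁.integrableOn.mul_prod hf₂.integrableOn)
  exact h.congr (Filter.Eventually.of_forall fun x => (hFun_eq f₁ f₂ x).symm)

/-- The two moment terms integrate to the edge masses and the product term to one; this surplus
makes the price 0 too low to balance the masses. -/
lemma integral_hFun {f₁ f₂ : ℝ → ℝ} (hf₁ : IsDensity f₁) (hf₂ : IsDensity f₂) :
    ∫ x in square, hFun f₁ f₂ x = f₁ 1 + f₂ 1 + 1 := by
  simp only [hFun_eq]
  rw [volume_restrict_square]
  rw [integral_add, integral_add, integral_prod_mul, integral_prod_mul, integral_prod_mul,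
    hf₁.setIntegral_eq_one, hf₂.setIntegral_eq_one,
    ← intervalIntegral_eq_setIntegral_unitI, ← intervalIntegral_eq_setIntegral_unitI,
    hf₁.integral_momentDeriv zero_mem_unitI, hf₂.integral_momentDeriv zero_mem_unitI]
  · ring
  · exact hf₁.integrableOn_momentDeriv.mul_prod hf₂.integrableOn
  · exact hf₁.integrableOn.mul_prod hf₂.integrableOn_momentDeriv
  · exact (hf₁.integrableOn_momentDeriv.mul_prod hf₂.integrableOn).add
      (hf₁.integrableOn.mul_prod hf₂.integrableOn_momentDeriv)
  · exact hf₁.integrableOn.mul_prod hf₂.integrableOn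

lemma IsRegular.hFun_nonneg {f₁ f₂ : ℝ → ℝ} (h : IsRegular f₁ f₂) (hf₁ : IsDensity f₁)
    (hf₂ : IsDensity f₂) {x : ℝ × ℝ} (hx : x ∈ square) : 0 ≤ hFun f₁ f₂ x := by
  have h1 := h.nonneg₁ x hx
  have h2 := mul_pos (hf₂.pos 1 one_mem_unitI) (hf₁.pos x.1 hx.1)
  linarith

/-- The measure on the square with density `h`. -/
noncomputable def innerMeasure (f₁ f₂ : ℝ → ℝ) : Measure (ℝ × ℝ) :=
  (volume.restrict square).withDensity fun x => ENNReal.ofReal (hFun f₁ f₂ x)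

/-- The measure on an edge of the square with density `c * g`. -/
noncomputable def edgeMeasure (c : ℝ) (g : ℝ → ℝ) : Measure ℝ :=
  (volume.restrict unitI).withDensity fun y => ENNReal.ofReal (c * g y)

/-- The points of the square to the right of the curve `x₁ = s(x₂)`. -/
def rightOf (s : ℝ → ℝ) : Set (ℝ × ℝ) := {x | x ∈ square ∧ s x.2 ≤ x.1}

/-- The points of the square above the curve `x₂ = s(x₁)`. -/
def aboveOf (s : ℝ → ℝ) : Set (ℝ × ℝ) := {x | x ∈ square ∧ s x.1 ≤ x.2}

lemma measurableSet_rightOf {s : ℝ → ℝ} (hs : ContinuousOn s unitI) :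
    MeasurableSet (rightOf s) :=
  (isClosed_square.isClosed_le (hs.comp continuousOn_snd fun _ hx => hx.2)
    continuousOn_fst).measurableSet

lemma aboveOf_eq (s : ℝ → ℝ) : aboveOf s = Prod.swap ⁻¹' rightOf s := by
  ext x
  simp only [aboveOf, rightOf, mem_ofPred_eq, mem_preimage, mem_square, Prod.fst_swap,
    Prod.snd_swap]
  tauto

lemma measurableSet_aboveOf {s : ℝ → ℝ} (hs : ContinuousOn s unitI) :
    MeasurableSet (aboveOf s) := by
  rw [aboveOf_eq]; exact measurable_swap (measurableSet_rightOf hs)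

lemma aemeasurable_innerDensity {f₁ f₂ : ℝ → ℝ} (hf₁ : IsDensity f₁) (hf₂ : IsDensity f₂) :
    AEMeasurable (fun x => ENNReal.ofReal (hFun f₁ f₂ x)) (volume.restrict square) :=
  (integrableOn_hFun hf₁ hf₂).aestronglyMeasurable.aemeasurable.ennreal_ofReal

lemma aemeasurable_edgeDensity {g : ℝ → ℝ} (hg : IsDensity g) (c : ℝ) :
    AEMeasurable (fun y => ENNReal.ofReal (c * g y)) (volume.restrict unitI) :=
  (hg.integrableOn.const_mul c).aestronglyMeasurable.aemeasurable.ennreal_ofReal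

lemma isFiniteMeasure_innerMeasure {f₁ f₂ : ℝ → ℝ} (hf₁ : IsDensity f₁) (hf₂ : IsDensity f₂) :
    IsFiniteMeasure (innerMeasure f₁ f₂) :=
  isFiniteMeasure_withDensity_ofReal (integrableOn_hFun hf₁ hf₂).2

lemma isFiniteMeasure_edgeMeasure {g : ℝ → ℝ} (hg : IsDensity g) (c : ℝ) :
    IsFiniteMeasure (edgeMeasure c g) :=
  isFiniteMeasure_withDensity_ofReal (hg.integrableOn.const_mul c).2

lemma ae_mem_square_innerMeasure (f₁ f₂ : ℝ → ℝ) :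
    ∀ᵐ x ∂(innerMeasure f₁ f₂), x ∈ square :=
  (withDensity_absolutelyContinuous _ _).ae_le (ae_restrict_mem measurableSet_square)

lemma ae_mem_unitI_edgeMeasure (c : ℝ) (g : ℝ → ℝ) : ∀ᵐ y ∂(edgeMeasure c g), y ∈ unitI :=
  (withDensity_absolutelyContinuous _ _).ae_le (ae_restrict_mem measurableSet_unitI)

/-- Exchanging the goods exchanges the two edges, so the top-edge projection follows from the
right-edge one. -/
lemma innerMeasure_swap (f₁ f₂ : ℝ → ℝ) :
    (innerMeasure f₁ f₂).map Prod.swap = innerMeasure f₂ f₁ := by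
  ext E hE
  rw [Measure.map_apply measurable_swap hE, innerMeasure, innerMeasure, withDensity_apply _ hE,
    withDensity_apply _ (measurable_swap hE), Measure.restrict_restrict hE,
    Measure.restrict_restrict (measurable_swap hE)]
  have h1 : Prod.swap ⁻¹' E ∩ square = Prod.swap ⁻¹' (E ∩ square) := by
    ext x; simp only [mem_inter_iff, mem_preimage, mem_square, Prod.fst_swap, Prod.snd_swap]; tauto
  have h2 : MeasurePreserving (Prod.swap : ℝ × ℝ → ℝ × ℝ) volume volume :=
    Measure.measurePreserving_swap
  rw [h1, ← h2.setLIntegral_comp_preimage_emb MeasurableEquiv.prodComm.measurableEmbedding]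
  simp only [hFun_swap]
  rfl

/-- The mass of `h` to the right of the curve, projected to the right edge. -/
lemma map_snd_innerMeasure_rightOf {f₁ f₂ s : ℝ → ℝ} (hf₁ : IsDensity f₁) (hf₂ : IsDensity f₂)
    (hreg : IsRegular f₁ f₂) (hs : MapsTo s unitI unitI) (hsc : ContinuousOn s unitI)
    (h : SolvesSlice f₁ f₂ s) :
    ((innerMeasure f₁ f₂).restrict (rightOf s)).map Prod.snd = edgeMeasure (f₁ 1) f₂ := by
  ext E hE
  have hA := measurableSet_rightOf hsc
  have hE' : MeasurableSet (Prod.snd ⁻¹' E : Set (ℝ × ℝ)) := measurable_snd hE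
  rw [Measure.map_apply measurable_snd hE, Measure.restrict_apply hE', innerMeasure, edgeMeasure,
    withDensity_apply _ hE, withDensity_apply _ (hE'.inter hA),
    ← lintegral_indicator (hE'.inter hA), ← lintegral_indicator hE, volume_restrict_square,
    lintegral_prod_symm]
  · have hint := integrableOn_hFun hf₁ hf₂
    rw [IntegrableOn, volume_restrict_square] at hint
    apply lintegral_congr_ae
    filter_upwards [ae_integral_slice hf₁ hf₂ hs h, ae_restrict_mem measurableSet_unitI,
      hint.prod_left_ae] with y hy hyI hyi
    by_cases hyE : y ∈ E
    · rw [indicator_of_mem hyE, ← hy, intervalIntegral.integral_of_le (hs hyI).2,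
        ← integral_Icc_eq_integral_Ioc]
      have hsub : Icc (s y) 1 ⊆ unitI := Icc_subset_Icc_left (hs hyI).1
      rw [ofReal_integral_eq_lintegral_ofReal]
      · have h1 : volume.restrict (Icc (s y) 1) = (volume.restrict unitI).restrict (Icc (s y) 1) := by
          rw [Measure.restrict_restrict measurableSet_Icc, inter_eq_left.2 hsub]
        rw [h1, ← lintegral_indicator measurableSet_Icc]
        apply lintegral_congr_ae
        filter_upwards [ae_restrict_mem measurableSet_unitI] with x hx
        by_cases hsx : s y ≤ x
        · rw [indicator_of_mem, indicator_of_mem]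
          · exact ⟨hsx, hx.2⟩
          · exact ⟨hyE, ⟨hx, hyI⟩, hsx⟩
        · rw [indicator_of_notMem, indicator_of_notMem]
          · exact fun h => hsx h.1
          · exact fun h => hsx h.2.2
      · exact IntegrableOn.mono_set hyi hsub
      · filter_upwards [ae_restrict_mem measurableSet_Icc] with x hx
        exact hreg.hFun_nonneg hf₁ hf₂ ⟨hsub hx, hyI⟩
    · rw [indicator_of_notMem hyE]
      rw [lintegral_eq_zero_of_ae_eq_zero]
      filter_upwards with x
      rw [indicator_of_notMem]
      · rfl
      · exact fun h => hyE h.1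
  · rw [← volume_restrict_square]
    exact (aemeasurable_innerDensity hf₁ hf₂).indicator (hE'.inter hA)

lemma IsRegular.swap {f₁ f₂ : ℝ → ℝ} (h : IsRegular f₁ f₂) : IsRegular f₂ f₁ where
  nonneg₁ x hx := by
    have := h.nonneg₂ x.swap ⟨hx.2, hx.1⟩
    rwa [hFun_swap f₂ f₁] at this
  nonneg₂ x hx := by
    have := h.nonneg₁ x.swap ⟨hx.2, hx.1⟩
    rwa [hFun_swap f₂ f₁] at this
  absCont₁ x hx := by
    have := h.absCont₂ x hx
    simpa only [← hFun_swap f₁ f₂, Prod.swap_prod_mk] using this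
  absCont₂ x hx := by
    have := h.absCont₁ x hx
    simpa only [← hFun_swap f₁ f₂, Prod.swap_prod_mk] using this

/-- The mass of `h` above the curve, projected to the top edge. -/
lemma map_fst_innerMeasure_aboveOf {f₁ f₂ s : ℝ → ℝ} (hf₁ : IsDensity f₁) (hf₂ : IsDensity f₂)
    (hreg : IsRegular f₁ f₂) (hs : MapsTo s unitI unitI) (hsc : ContinuousOn s unitI)
    (h : SolvesSlice f₂ f₁ s) :
    ((innerMeasure f₁ f₂).restrict (aboveOf s)).map Prod.fst = edgeMeasure (f₂ 1) f₁ := by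
  rw [← map_snd_innerMeasure_rightOf hf₂ hf₁ hreg.swap hs hsc h, ← innerMeasure_swap f₁ f₂,
    Measure.restrict_map measurable_swap (measurableSet_rightOf hsc), ← aboveOf_eq,
    Measure.map_map measurable_snd measurable_swap]
  rfl

lemma integral_innerMeasure {f₁ f₂ : ℝ → ℝ} (hf₁ : IsDensity f₁) (hf₂ : IsDensity f₂)
    (hreg : IsRegular f₁ f₂) (v : ℝ × ℝ → ℝ) :
    ∫ x, v x ∂(innerMeasure f₁ f₂) = ∫ x in square, v x * hFun f₁ f₂ x := by
  rw [innerMeasure, integral_withDensity_eq_integral_toReal_smul₀ (aemeasurable_innerDensity hf₁ hf₂)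
    (Filter.Eventually.of_forall fun _ => ENNReal.ofReal_lt_top)]
  apply setIntegral_congr_fun measurableSet_square
  intro x hx
  simp only [smul_eq_mul]
  rw [ENNReal.toReal_ofReal (hreg.hFun_nonneg hf₁ hf₂ hx), mul_comm]

lemma integral_edgeMeasure {g : ℝ → ℝ} (hg : IsDensity g) {c : ℝ} (hc : 0 ≤ c) (v : ℝ → ℝ) :
    ∫ y, v y ∂(edgeMeasure c g) = c * ∫ y in unitI, v y * g y := by
  rw [edgeMeasure, integral_withDensity_eq_integral_toReal_smul₀ (aemeasurable_edgeDensity hg c)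
    (Filter.Eventually.of_forall fun _ => ENNReal.ofReal_lt_top), ← integral_const_mul]
  apply setIntegral_congr_fun measurableSet_unitI
  intro y hy
  simp only [smul_eq_mul]
  rw [ENNReal.toReal_ofReal (mul_nonneg hc (hg.pos y hy).le)]
  ring

lemma innerMeasure_apply {f₁ f₂ : ℝ → ℝ} (hf₁ : IsDensity f₁) (hf₂ : IsDensity f₂)
    (hreg : IsRegular f₁ f₂) {A : Set (ℝ × ℝ)} (hA : MeasurableSet A) (hAs : A ⊆ square) :
    innerMeasure f₁ f₂ A = ENNReal.ofReal (∫ x in A, hFun f₁ f₂ x) := by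
  rw [innerMeasure, withDensity_apply _ hA, Measure.restrict_restrict hA, inter_eq_left.2 hAs,
    ofReal_integral_eq_lintegral_ofReal ((integrableOn_hFun hf₁ hf₂).mono_set hAs)]
  filter_upwards [ae_restrict_mem hA] with x hx
  exact hreg.hFun_nonneg hf₁ hf₂ (hAs hx)

lemma edgeMeasure_univ {g : ℝ → ℝ} (hg : IsDensity g) {c : ℝ} (hc : 0 ≤ c) :
    edgeMeasure c g univ = ENNReal.ofReal c := by
  rw [edgeMeasure, withDensity_apply _ MeasurableSet.univ, Measure.restrict_univ,
    ← ofReal_integral_eq_lintegral_ofReal (hg.integrableOn.const_mul c), integral_const_mul,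
    hg.setIntegral_eq_one, mul_one]
  filter_upwards [ae_restrict_mem measurableSet_unitI] with y hy
  exact mul_nonneg hc (hg.pos y hy).le

/-- Absence of atoms makes open and closed half-lines interchangeable when superlevel sets on the
edges are compared with half-lines. -/
instance (c : ℝ) (g : ℝ → ℝ) : NullSingletonClass (edgeMeasure c g) :=
  ⟨fun x => withDensity_absolutelyContinuous _ _ (measure_singleton x)⟩

/-! ### Tangent lines of the curves -/

namespace IsSlopeCurve

variable {s : ℝ → ℝ}

lemma continuousOn (hs : IsSlopeCurve s) : ContinuousOn s unitI := fun t ht =>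
  let ⟨_, _, hd⟩ := hs.slope t ht
  hd.continuousWithinAt

/-- Slopes of supporting lines can be chosen in `[-1, 0]`. -/
lemma exists_supergradient (hs : IsSlopeCurve s) {t : ℝ} (ht : t ∈ unitI) :
    ∃ d : ℝ, -1 ≤ d ∧ d ≤ 0 ∧ ∀ y ∈ unitI, s y ≤ s t + d * (y - t) := by
  -- The (one-sided) derivative itself serves as the slope: monotonicity makes it nonpositive, and
  -- concavity puts the graph below the tangent line.
  obtain ⟨d, hd1, hd⟩ := hs.slope t ht
  have hacc : AccPt t (Filter.principal unitI) :=
    (uniqueDiffOn_Icc zero_lt_one t ht).accPt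
  refine ⟨d, hd1.le, hd.nonpos_of_antitoneOn hacc hs.antitone, fun y hy => ?_⟩
  rcases lt_trichotomy y t with h | h | h
  · have h1 := hs.concave.le_slope_of_hasDerivWithinAt hy ht h hd
    rw [slope_def_field, le_div_iff₀ (by linarith)] at h1
    linarith
  · simp [h]
  · have h1 := hs.concave.slope_le_of_hasDerivWithinAt ht hy h hd
    rw [slope_def_field, div_le_iff₀ (by linarith)] at h1
    linarith

/-- This is the monotonicity of `t + s t`, a consequence of slopes being at least `-1`; it controls
on which side of the line `x₁ + x₂ = p` the curves run. -/
lemma sub_le_sub (hs : IsSlopeCurve s) {x y : ℝ} (hx : x ∈ unitI) (hy : y ∈ unitI)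
    (hxy : x ≤ y) : s x - s y ≤ y - x := by
  obtain ⟨d, hd, -, h⟩ := hs.exists_supergradient hy
  nlinarith [h x hx]

end IsSlopeCurve

/-! ### The crossing of the curves, and the shape of the region around its corner -/

/-- A fixed point of `s₁ ∘ s₂` on the interval gives a common point of the two curves. -/
lemma exists_crossing {s₁ s₂ : ℝ → ℝ} (hs₁ : IsSlopeCurve s₁) (hs₂ : IsSlopeCurve s₂) :
    ∃ q₁ ∈ unitI, ∃ q₂ ∈ unitI, s₁ q₂ = q₁ ∧ s₂ q₁ = q₂ := by
  obtain ⟨c, hc, h⟩ := exists_mem_Icc_isFixedPt_of_mapsTo (f := s₁ ∘ s₂) (a := 0) (b := 1)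
    (hs₁.continuousOn.comp hs₂.continuousOn hs₂.mapsTo) zero_le_one
    (hs₁.mapsTo.comp hs₂.mapsTo)
  exact ⟨c, hc, s₂ c, hs₂.mapsTo hc, h, rfl⟩

/-- The corner `(c₁, c₂)` of the part of the region `D` where both goods are sold: it separates
this part from the parts where the curves `x₁ = s₁(x₂)` and `x₂ = s₂(x₁)` matter. -/
structure IsCorner (s₁ s₂ : ℝ → ℝ) (p c₁ c₂ : ℝ) : Prop where
  mem₁ : c₁ ∈ unitI
  mem₂ : c₂ ∈ unitI
  le₁ : p ≤ c₁ + s₂ c₁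
  le₂ : p ≤ c₂ + s₁ c₂
  lt₁ : ∀ x ∈ unitI, x < c₁ → x + s₂ x < p
  lt₂ : ∀ x ∈ unitI, x < c₂ → x + s₁ x < p
  le_curve₁ : c₁ ≤ s₁ c₂
  le_curve₂ : c₂ ≤ s₂ c₁

lemma IsCorner.swap {s₁ s₂ : ℝ → ℝ} {p c₁ c₂ : ℝ} (h : IsCorner s₁ s₂ p c₁ c₂) :
    IsCorner s₂ s₁ p c₂ c₁ :=
  ⟨h.mem₂, h.mem₁, h.le₂, h.le₁, h.lt₂, h.lt₁, h.le_curve₂, h.le_curve₁⟩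

/-- The first point at which `x + s(x)` reaches the level `p`. -/
lemma exists_first_crossing {s : ℝ → ℝ} (hs : IsSlopeCurve s) {p q : ℝ} (hq : q ∈ unitI)
    (hp : p ≤ q + s q) :
    ∃ c ∈ unitI, c ≤ q ∧ p ≤ c + s c ∧ ∀ x ∈ unitI, x < c → x + s x < p := by
  have hcl : IsClosed {x | x ∈ unitI ∧ p ≤ x + s x} :=
    isClosed_Icc.isClosed_le continuousOn_const (continuousOn_id.add hs.continuousOn)
  have hco : IsCompact {x | x ∈ unitI ∧ p ≤ x + s x} :=
    isCompact_unitI.of_isClosed_subset hcl fun x hx => hx.1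
  obtain ⟨c, hc, hmin⟩ := hco.exists_isLeast ⟨q, hq, hp⟩
  refine ⟨c, hc.1, hmin ⟨hq, hp⟩, hc.2, fun x hx hxc => ?_⟩
  by_contra! h
  exact absurd (hmin ⟨hx, h⟩) (not_le.2 hxc)

/-- At the crossing `q` both `q₁ + s₂(q₁)` and `q₂ + s₁(q₂)` equal `q₁ + q₂ ≥ p`, so the first times
at level `p` exist and satisfy `c ≤ q`. Since the curves decrease, `s₁(c₂) ≥ s₁(q₂) = q₁ ≥ c₁`, and
symmetrically. -/
lemma exists_isCorner {s₁ s₂ : ℝ → ℝ} (hs₁ : IsSlopeCurve s₁) (hs₂ : IsSlopeCurve s₂)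
    {p q₁ q₂ : ℝ} (hq₁ : q₁ ∈ unitI) (hq₂ : q₂ ∈ unitI) (h₁ : s₁ q₂ = q₁) (h₂ : s₂ q₁ = q₂)
    (hp : p ≤ q₁ + q₂) : ∃ c₁ c₂, IsCorner s₁ s₂ p c₁ c₂ := by
  obtain ⟨c₁, hc₁, hcq₁, hle₁, hlt₁⟩ := exists_first_crossing hs₂ hq₁ (p := p) (by linarith)
  obtain ⟨c₂, hc₂, hcq₂, hle₂, hlt₂⟩ := exists_first_crossing hs₁ hq₂ (p := p) (by linarith)
  refine ⟨c₁, c₂, hc₁, hc₂, hle₁, hle₂, hlt₁, hlt₂, ?_, ?_⟩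
  · have := hs₁.antitone hc₂ hq₂ hcq₂
    linarith
  · have := hs₂.antitone hc₁ hq₁ hcq₁
    linarith

namespace IsCorner

variable {s₁ s₂ : ℝ → ℝ} {p c₁ c₂ : ℝ}

lemma le_add_curve₁ (h : IsCorner s₁ s₂ p c₁ c₂) (hs₂ : IsSlopeCurve s₂) {x : ℝ}
    (hx : x ∈ unitI) (hcx : c₁ ≤ x) : p ≤ x + s₂ x := by
  have := hs₂.sub_le_sub h.mem₁ hx hcx
  linarith [h.le₁]

lemma le_add_curve₂ (h : IsCorner s₁ s₂ p c₁ c₂) (hs₁ : IsSlopeCurve s₁) {x : ℝ}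
    (hx : x ∈ unitI) (hcx : c₂ ≤ x) : p ≤ x + s₁ x :=
  h.swap.le_add_curve₁ hs₁ hx hcx

lemma le_fst_of_mem_rightOf (h : IsCorner s₁ s₂ p c₁ c₂) (hs₁ : IsSlopeCurve s₁) {x : ℝ × ℝ}
    (hx : x ∈ rightOf s₁) (hc : x.2 ≤ c₂) : c₁ ≤ x.1 := by
  have := hs₁.antitone hx.1.2 h.mem₂ hc
  linarith [h.le_curve₁, hx.2]

lemma le_snd_of_mem_aboveOf (h : IsCorner s₁ s₂ p c₁ c₂) (hs₂ : IsSlopeCurve s₂) {x : ℝ × ℝ}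
    (hx : x ∈ aboveOf s₂) (hc : x.1 ≤ c₁) : c₂ ≤ x.2 :=
  h.swap.le_fst_of_mem_rightOf hs₂ (x := x.swap) ⟨⟨hx.1.2, hx.1.1⟩, hx.2⟩ hc

/-- Below height `c₂` the curve `s₁` runs to the left of the line `x₁ + x₂ = p`, so the line adds
nothing. A point above the curve `s₂` at such a height has `x₁ ≥ c₁`, where `x₁ + s₂(x₁) ≥ p`; so it
lies beyond the line, hence to the right of `s₁`. -/
lemma mem_region_iff_rightOf (h : IsCorner s₁ s₂ p c₁ c₂) (hs₂ : IsSlopeCurve s₂) {x : ℝ × ℝ}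
    (hc : x.2 < c₂) : x ∈ region s₁ s₂ p ↔ x ∈ rightOf s₁ := by
  refine ⟨fun hx => ⟨hx.1, ?_⟩, fun hx => ⟨hx.1, Or.inr (Or.inl hx.2)⟩⟩
  have h1 := h.lt₂ x.2 hx.1.2 hc
  rcases hx.2 with h2 | h2 | h2
  · linarith
  · exact h2
  · have h3 : c₁ ≤ x.1 := by
      by_contra! h4
      exact absurd (h.le_snd_of_mem_aboveOf hs₂ ⟨hx.1, h2⟩ h4.le) (not_le.2 hc)
    linarith [h.le_add_curve₁ hs₂ hx.1.1 h3]

lemma mem_region_iff_aboveOf (h : IsCorner s₁ s₂ p c₁ c₂) (hs₁ : IsSlopeCurve s₁) {x : ℝ × ℝ}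
    (hc : x.1 < c₁) : x ∈ region s₁ s₂ p ↔ x ∈ aboveOf s₂ := by
  have h1 := h.swap.mem_region_iff_rightOf hs₁ (x := x.swap) hc
  simp only [region, rightOf, aboveOf, mem_ofPred_eq, mem_square, Prod.fst_swap, Prod.snd_swap,
    add_comm x.2] at h1 ⊢
  tauto

/-- Beyond the corner `t + sᵢ(t) ≥ p`, so a point past either curve is already past the line. -/
lemma mem_region_iff_add (h : IsCorner s₁ s₂ p c₁ c₂) (hs₁ : IsSlopeCurve s₁)
    (hs₂ : IsSlopeCurve s₂) {x : ℝ × ℝ} (hx : x ∈ square) (hc₁ : c₁ ≤ x.1) (hc₂ : c₂ ≤ x.2) :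
    x ∈ region s₁ s₂ p ↔ p ≤ x.1 + x.2 := by
  refine ⟨fun hx' => ?_, fun h' => ⟨hx, Or.inl h'⟩⟩
  have h1 := h.le_add_curve₁ hs₂ hx.1 hc₁
  have h2 := h.le_add_curve₂ hs₁ hx.2 hc₂
  rcases hx'.2 with h3 | h3 | h3 <;> linarith

end IsCorner

/-- At and above the level of the crossing of the curves, the bundle price has no influence on the
region. -/
lemma region_crossing_subset {s₁ s₂ : ℝ → ℝ} (hs₁ : IsSlopeCurve s₁) (hs₂ : IsSlopeCurve s₂)
    {q₁ q₂ : ℝ} (hq₁ : q₁ ∈ unitI) (hq₂ : q₂ ∈ unitI) (h₁ : s₁ q₂ = q₁) (h₂ : s₂ q₁ = q₂) :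
    region s₁ s₂ (q₁ + q₂) ⊆ rightOf s₁ ∪ aboveOf s₂ := by
  rintro x ⟨hx, h | h | h⟩
  · by_contra h3
    rw [mem_union, not_or] at h3
    have h4 : x.1 < s₁ x.2 := by by_contra! h5; exact h3.1 ⟨hx, h5⟩
    have h5 : x.2 < s₂ x.1 := by by_contra! h5; exact h3.2 ⟨hx, h5⟩
    rcases le_total q₂ x.2 with h6 | h6
    · have h7 := hs₁.antitone hq₂ hx.2 h6
      have h8 : x.1 ≤ q₁ := by linarith
      have := hs₂.sub_le_sub hx.1 hq₁ h8
      linarith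
    · have := hs₁.sub_le_sub hx.2 hq₂ h6
      linarith
  · exact Or.inl ⟨hx, h⟩
  · exact Or.inr ⟨hx, h⟩

/-! ### The balanced bundle price -/

lemma region_eq (s₁ s₂ : ℝ → ℝ) (p : ℝ) :
    region s₁ s₂ p = (square ∩ {x | p ≤ x.1 + x.2}) ∪ (rightOf s₁ ∪ aboveOf s₂) := by
  ext x
  simp only [region, rightOf, aboveOf, mem_ofPred_eq, mem_union, mem_inter_iff]
  tauto

lemma measurableSet_le_add (p : ℝ) : MeasurableSet {x : ℝ × ℝ | p ≤ x.1 + x.2} :=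
  measurableSet_le measurable_const (measurable_fst.add measurable_snd)

lemma measurableSet_region {s₁ s₂ : ℝ → ℝ} (hs₁ : IsSlopeCurve s₁) (hs₂ : IsSlopeCurve s₂)
    (p : ℝ) : MeasurableSet (region s₁ s₂ p) := by
  rw [region_eq]
  exact (measurableSet_square.inter (measurableSet_le_add p)).union
    ((measurableSet_rightOf hs₁.continuousOn).union (measurableSet_aboveOf hs₂.continuousOn))

lemma volume_antidiagonal (p : ℝ) : volume {x : ℝ × ℝ | x.1 + x.2 = p} = 0 := by
  have hm : MeasurableSet {x : ℝ × ℝ | x.1 + x.2 = p} :=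
    measurableSet_eq_fun (measurable_fst.add measurable_snd) measurable_const
  rw [Measure.volume_eq_prod, Measure.measure_prod_null hm]
  filter_upwards with x
  have : Prod.mk x ⁻¹' {x : ℝ × ℝ | x.1 + x.2 = p} = {p - x} := by
    ext y
    simp only [mem_preimage, mem_ofPred_eq, mem_singleton_iff]
    constructor <;> intro h <;> linarith
  rw [this]; simp

/-- Dominated convergence: off the null line `x₁ + x₂ = p`, membership of a point in the region does
not change for prices near `p`. -/
lemma continuous_integral_region {s₁ s₂ : ℝ → ℝ} (hs₁ : IsSlopeCurve s₁) (hs₂ : IsSlopeCurve s₂)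
    {g : ℝ × ℝ → ℝ} (hg : IntegrableOn g square) :
    Continuous fun p => ∫ x in region s₁ s₂ p, g x := by
  have heq : ∀ p, ∫ x in region s₁ s₂ p, g x
      = ∫ x in square, (region s₁ s₂ p).indicator g x := fun p => by
    rw [setIntegral_indicator (measurableSet_region hs₁ hs₂ p)]
    congr 2
    ext x
    exact ⟨fun h => ⟨h.1, h⟩, fun h => h.2⟩
  simp only [heq]
  refine continuous_iff_continuousAt.2 fun p => ?_
  refine continuousAt_of_dominated (bound := fun x => ‖g x‖) ?_ ?_ hg.norm ?_
  · filter_upwards with r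
    exact hg.aestronglyMeasurable.indicator (measurableSet_region hs₁ hs₂ r)
  · filter_upwards with r
    filter_upwards with x
    exact norm_indicator_le_norm_self g x
  · have h0 : ∀ᵐ x ∂(volume.restrict square), x.1 + x.2 ≠ p :=
      ae_restrict_of_ae (measure_eq_zero_iff_ae_notMem.1 (volume_antidiagonal p))
    filter_upwards [h0] with x hx
    have key : ∀ᶠ r in nhds p, (r ≤ x.1 + x.2 ↔ p ≤ x.1 + x.2) := by
      rcases lt_or_gt_of_ne hx with h | h
      · filter_upwards [lt_mem_nhds h] with r hr
        exact ⟨fun h' => absurd h' (not_le.2 hr), fun h' => absurd h' (not_le.2 h)⟩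
      · filter_upwards [gt_mem_nhds h] with r hr
        exact ⟨fun _ => h.le, fun _ => hr.le⟩
    refine (continuousAt_const (y := (region s₁ s₂ p).indicator g x)).congr ?_
    filter_upwards [key] with r hr
    have : x ∈ region s₁ s₂ r ↔ x ∈ region s₁ s₂ p := by
      simp only [region, mem_ofPred_eq, hr]
    by_cases hxr : x ∈ region s₁ s₂ p
    · rw [indicator_of_mem hxr, indicator_of_mem (this.2 hxr)]
    · rw [indicator_of_notMem hxr, indicator_of_notMem fun h => hxr (this.1 h)]

lemma innerMeasure_rightOf {f₁ f₂ s : ℝ → ℝ} (hf₁ : IsDensity f₁) (hf₂ : IsDensity f₂)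
    (hreg : IsRegular f₁ f₂) (hs : IsSlopeCurve s) (h : SolvesSlice f₁ f₂ s) {E : Set ℝ}
    (hE : MeasurableSet E) :
    innerMeasure f₁ f₂ (Prod.snd ⁻¹' E ∩ rightOf s) = edgeMeasure (f₁ 1) f₂ E := by
  rw [← map_snd_innerMeasure_rightOf hf₁ hf₂ hreg hs.mapsTo hs.continuousOn h,
    Measure.map_apply measurable_snd hE, Measure.restrict_apply (measurable_snd hE)]

lemma innerMeasure_aboveOf {f₁ f₂ s : ℝ → ℝ} (hf₁ : IsDensity f₁) (hf₂ : IsDensity f₂)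
    (hreg : IsRegular f₁ f₂) (hs : IsSlopeCurve s) (h : SolvesSlice f₂ f₁ s) {E : Set ℝ}
    (hE : MeasurableSet E) :
    innerMeasure f₁ f₂ (Prod.fst ⁻¹' E ∩ aboveOf s) = edgeMeasure (f₂ 1) f₁ E := by
  rw [← map_fst_innerMeasure_aboveOf hf₁ hf₂ hreg hs.mapsTo hs.continuousOn h,
    Measure.map_apply measurable_fst hE, Measure.restrict_apply (measurable_fst hE)]

/-- A price for the bundle that balances the mass of `h` on the region with the edge masses. -/
lemma exists_balanced_price {f₁ f₂ s₁ s₂ : ℝ → ℝ} (hf₁ : IsDensity f₁) (hf₂ : IsDensity f₂)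
    (hreg : IsRegular f₁ f₂) (hs₁ : IsSlopeCurve s₁) (hs₂ : IsSlopeCurve s₂)
    (h₁ : SolvesSlice f₁ f₂ s₁) (h₂ : SolvesSlice f₂ f₁ s₂) :
    ∃ p ∈ Icc (0 : ℝ) 2, ∫ x in region s₁ s₂ p, hFun f₁ f₂ x = f₁ 1 + f₂ 1 ∧
      ∃ c₁ c₂, IsCorner s₁ s₂ p c₁ c₂ := by
  obtain ⟨q₁, hq₁, q₂, hq₂, hsq₁, hsq₂⟩ := exists_crossing hs₁ hs₂
  have hq : 0 ≤ q₁ + q₂ := add_nonneg hq₁.1 hq₂.1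
  have hint := integrableOn_hFun hf₁ hf₂
  have hf₁1 := hf₁.pos 1 one_mem_unitI
  have hf₂1 := hf₂.pos 1 one_mem_unitI
  have hsub : ∀ p, region s₁ s₂ p ⊆ square := fun p x hx => hx.1
  have h0 : region s₁ s₂ 0 = square :=
    (hsub 0).antisymm fun x hx => ⟨hx, Or.inl (add_nonneg hx.1.1 hx.2.1)⟩
  have hlow : f₁ 1 + f₂ 1 ≤ ∫ x in region s₁ s₂ 0, hFun f₁ f₂ x := by
    rw [h0, integral_hFun hf₁ hf₂]; linarith
  -- At the price `q₁ + q₂` the region is covered by the parts beyond the two curves, whose masses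
  -- are exactly the two edge masses; their overlap only helps.
  have hhigh : ∫ x in region s₁ s₂ (q₁ + q₂), hFun f₁ f₂ x ≤ f₁ 1 + f₂ 1 := by
    rw [← ENNReal.ofReal_le_ofReal_iff (by positivity), ← innerMeasure_apply hf₁ hf₂ hreg
      (measurableSet_region hs₁ hs₂ _) (hsub _), ENNReal.ofReal_add hf₁1.le hf₂1.le,
      ← edgeMeasure_univ hf₂ hf₁1.le, ← edgeMeasure_univ hf₁ hf₂1.le,
      ← innerMeasure_rightOf hf₁ hf₂ hreg hs₁ h₁ MeasurableSet.univ,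
      ← innerMeasure_aboveOf hf₁ hf₂ hreg hs₂ h₂ MeasurableSet.univ]
    simp only [preimage_univ, univ_inter]
    exact (measure_mono (region_crossing_subset hs₁ hs₂ hq₁ hq₂ hsq₁ hsq₂)).trans
      (measure_union_le _ _)
  obtain ⟨p, hp, hpe⟩ := intermediate_value_Icc' hq
    (continuous_integral_region hs₁ hs₂ hint).continuousOn ⟨hhigh, hlow⟩
  exact ⟨p, ⟨hp.1, by linarith [hp.2, hq₁.2, hq₂.2]⟩, hpe,
    exists_isCorner hs₁ hs₂ hq₁ hq₂ hsq₁ hsq₂ hp.2⟩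

/-! ### Mass comparison on corner-shaped sets -/

/-- Regular densities together with curves that solve the slice equations. -/
structure IsSolved (f₁ f₂ s₁ s₂ : ℝ → ℝ) : Prop where
  dens₁ : IsDensity f₁
  dens₂ : IsDensity f₂
  reg : IsRegular f₁ f₂
  curve₁ : IsSlopeCurve s₁
  curve₂ : IsSlopeCurve s₂
  slice₁ : SolvesSlice f₁ f₂ s₁
  slice₂ : SolvesSlice f₂ f₁ s₂

/-- The part of the square above the line `x₁ + x₂ = p` and the corner `b`. -/
def cornerRegion (p b₁ b₂ : ℝ) : Set (ℝ × ℝ) :=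
  {x | x ∈ square ∧ b₁ ≤ x.1 ∧ b₂ ≤ x.2 ∧ p ≤ x.1 + x.2}

lemma measurableSet_cornerRegion (p b₁ b₂ : ℝ) : MeasurableSet (cornerRegion p b₁ b₂) :=
  measurableSet_square.inter ((measurableSet_le measurable_const measurable_fst).inter
    ((measurableSet_le measurable_const measurable_snd).inter (measurableSet_le_add p)))

lemma measure_Iio_add_Ici (μ : Measure ℝ) (c : ℝ) : μ (Iio c) + μ (Ici c) = μ univ := by
  rw [← compl_Iio]; exact measure_add_measure_compl measurableSet_Iio

lemma measure_Ico_add_Ici (μ : Measure ℝ) {c b : ℝ} (hcb : c ≤ b) :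
    μ (Ico c b) + μ (Ici b) = μ (Ici c) := by
  have hd : Disjoint (Ico c b) (Ici b) :=
    disjoint_left.2 fun x h1 h2 => absurd h2 (not_le.2 h1.2)
  rw [← measure_union hd measurableSet_Ici, Ico_union_Ici_eq_Ici hcb]

namespace IsSolved

variable {f₁ f₂ s₁ s₂ : ℝ → ℝ} {p c₁ c₂ : ℝ}

lemma isFinite_inner (h : IsSolved f₁ f₂ s₁ s₂) : IsFiniteMeasure (innerMeasure f₁ f₂) :=
  isFiniteMeasure_innerMeasure h.dens₁ h.dens₂

lemma isFinite_right (h : IsSolved f₁ f₂ s₁ s₂) : IsFiniteMeasure (edgeMeasure (f₁ 1) f₂) :=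
  isFiniteMeasure_edgeMeasure h.dens₂ _

lemma isFinite_top (h : IsSolved f₁ f₂ s₁ s₂) : IsFiniteMeasure (edgeMeasure (f₂ 1) f₁) :=
  isFiniteMeasure_edgeMeasure h.dens₁ _

lemma inner_rightOf (h : IsSolved f₁ f₂ s₁ s₂) {E : Set ℝ} (hE : MeasurableSet E) :
    innerMeasure f₁ f₂ (Prod.snd ⁻¹' E ∩ rightOf s₁) = edgeMeasure (f₁ 1) f₂ E :=
  innerMeasure_rightOf h.dens₁ h.dens₂ h.reg h.curve₁ h.slice₁ hE

lemma inner_aboveOf (h : IsSolved f₁ f₂ s₁ s₂) {E : Set ℝ} (hE : MeasurableSet E) :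
    innerMeasure f₁ f₂ (Prod.fst ⁻¹' E ∩ aboveOf s₂) = edgeMeasure (f₂ 1) f₁ E :=
  innerMeasure_aboveOf h.dens₁ h.dens₂ h.reg h.curve₂ h.slice₂ hE

lemma measurableSet_right (h : IsSolved f₁ f₂ s₁ s₂) (c : ℝ) :
    MeasurableSet (Prod.snd ⁻¹' Iio c ∩ rightOf s₁) :=
  (measurable_snd measurableSet_Iio).inter (measurableSet_rightOf h.curve₁.continuousOn)

lemma measurableSet_above (h : IsSolved f₁ f₂ s₁ s₂) (c : ℝ) :
    MeasurableSet (Prod.fst ⁻¹' Iio c ∩ aboveOf s₂) :=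
  (measurable_fst measurableSet_Iio).inter (measurableSet_aboveOf h.curve₂.continuousOn)

lemma region_decomposition (h : IsSolved f₁ f₂ s₁ s₂) (hc : IsCorner s₁ s₂ p c₁ c₂) :
    region s₁ s₂ p = (Prod.snd ⁻¹' Iio c₂ ∩ rightOf s₁) ∪
      ((Prod.fst ⁻¹' Iio c₁ ∩ aboveOf s₂) ∪ cornerRegion p c₁ c₂) := by
  ext x
  simp only [mem_union, mem_inter_iff, mem_preimage, mem_Iio]
  constructor
  · intro hx
    by_cases h1 : x.2 < c₂
    · exact Or.inl ⟨h1, (hc.mem_region_iff_rightOf h.curve₂ h1).1 hx⟩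
    · by_cases h2 : x.1 < c₁
      · exact Or.inr (Or.inl ⟨h2, (hc.mem_region_iff_aboveOf h.curve₁ h2).1 hx⟩)
      · rw [not_lt] at h1 h2
        exact Or.inr (Or.inr ⟨hx.1, h2, h1,
          (hc.mem_region_iff_add h.curve₁ h.curve₂ hx.1 h2 h1).1 hx⟩)
  · rintro (hx | hx | hx)
    · exact (hc.mem_region_iff_rightOf h.curve₂ hx.1).2 hx.2
    · exact (hc.mem_region_iff_aboveOf h.curve₁ hx.1).2 hx.2
    · exact ⟨hx.1, Or.inl hx.2.2.2⟩

lemma disjoint_above_corner (p c₁ c₂ : ℝ) (s₂ : ℝ → ℝ) :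
    Disjoint (Prod.fst ⁻¹' Iio c₁ ∩ aboveOf s₂) (cornerRegion p c₁ c₂) :=
  disjoint_left.2 fun _ h1 h2 => absurd h2.2.1 (not_le.2 h1.1)

lemma disjoint_right_rest (h : IsSolved f₁ f₂ s₁ s₂) (hc : IsCorner s₁ s₂ p c₁ c₂) :
    Disjoint (Prod.snd ⁻¹' Iio c₂ ∩ rightOf s₁)
      ((Prod.fst ⁻¹' Iio c₁ ∩ aboveOf s₂) ∪ cornerRegion p c₁ c₂) := by
  refine disjoint_left.2 fun x h1 h2 => ?_
  rcases h2 with h2 | h2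
  · exact absurd (hc.le_fst_of_mem_rightOf h.curve₁ h1.2 (mem_Iio.1 h1.1).le) (not_le.2 h2.1)
  · exact absurd h2.2.2.1 (not_le.2 h1.1)

/-- The central part of the region is balanced, too. -/
lemma inner_cornerRegion (h : IsSolved f₁ f₂ s₁ s₂) (hc : IsCorner s₁ s₂ p c₁ c₂)
    (hp : ∫ x in region s₁ s₂ p, hFun f₁ f₂ x = f₁ 1 + f₂ 1) :
    innerMeasure f₁ f₂ (cornerRegion p c₁ c₂) =
      edgeMeasure (f₁ 1) f₂ (Ici c₂) + edgeMeasure (f₂ 1) f₁ (Ici c₁) := by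
  have := h.isFinite_right
  have := h.isFinite_top
  have hf₁1 := (h.dens₁.pos 1 one_mem_unitI).le
  have hf₂1 := (h.dens₂.pos 1 one_mem_unitI).le
  have h1 := innerMeasure_apply h.dens₁ h.dens₂ h.reg (measurableSet_region h.curve₁ h.curve₂ p)
    fun x hx => hx.1
  rw [hp, ENNReal.ofReal_add hf₁1 hf₂1, ← edgeMeasure_univ h.dens₂ hf₁1,
    ← edgeMeasure_univ h.dens₁ hf₂1, h.region_decomposition hc,
    measure_union (h.disjoint_right_rest hc)
      ((h.measurableSet_above c₁).union (measurableSet_cornerRegion p c₁ c₂)),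
    measure_union (disjoint_above_corner p c₁ c₂ s₂) (measurableSet_cornerRegion p c₁ c₂),
    h.inner_rightOf measurableSet_Iio, h.inner_aboveOf measurableSet_Iio,
    ← measure_Iio_add_Ici _ c₂, ← measure_Iio_add_Ici (edgeMeasure (f₂ 1) f₁) c₁,
    ← add_assoc, add_add_add_comm] at h1
  exact (ENNReal.add_right_inj (by finiteness)).1 h1

/-- Moving the left side from `c₁` to `b₁` loses at least the strip above `s₂` over `[c₁, b₁)`,
whose mass is the top-edge mass of that interval. Beyond `c₁` the part above the curve lies past the
line, and `hb` keeps it at height at least `b₂`. -/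
lemma inner_cornerRegion_add_le_fst (h : IsSolved f₁ f₂ s₁ s₂) (hc : IsCorner s₁ s₂ p c₁ c₂)
    {b₁ b₂ : ℝ} (hcb : c₁ ≤ b₁) (hb : ∀ x ∈ unitI, x < b₁ → b₂ ≤ s₂ x) :
    innerMeasure f₁ f₂ (cornerRegion p b₁ b₂) + edgeMeasure (f₂ 1) f₁ (Ico c₁ b₁) ≤
      innerMeasure f₁ f₂ (cornerRegion p c₁ b₂) := by
  rw [← h.inner_aboveOf measurableSet_Ico, ← measure_union]
  · refine measure_mono (union_subset ?_ ?_)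
    · exact fun x hx => ⟨hx.1, hcb.trans hx.2.1, hx.2.2⟩
    · rintro x ⟨⟨hx1, hx2⟩, hx3, hx4⟩
      have h1 := hc.le_add_curve₁ h.curve₂ hx3.1 hx1
      have h2 := hb _ hx3.1 hx2
      exact ⟨hx3, hx1, by linarith, by linarith⟩
  · exact disjoint_left.2 fun x h1 h2 => absurd h1.2.1 (not_le.2 h2.1.2)
  · exact (measurable_fst measurableSet_Ico).inter (measurableSet_aboveOf h.curve₂.continuousOn)

lemma inner_cornerRegion_add_le_snd (h : IsSolved f₁ f₂ s₁ s₂) (hc : IsCorner s₁ s₂ p c₁ c₂)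
    {b₁ b₂ : ℝ} (hcb : c₂ ≤ b₂) (hb : ∀ x ∈ unitI, x < b₂ → b₁ ≤ s₁ x) :
    innerMeasure f₁ f₂ (cornerRegion p b₁ b₂) + edgeMeasure (f₁ 1) f₂ (Ico c₂ b₂) ≤
      innerMeasure f₁ f₂ (cornerRegion p b₁ c₂) := by
  rw [← h.inner_rightOf measurableSet_Ico, ← measure_union]
  · refine measure_mono (union_subset ?_ ?_)
    · exact fun x hx => ⟨hx.1, hx.2.1, hcb.trans hx.2.2.1, hx.2.2.2⟩
    · rintro x ⟨⟨hx1, hx2⟩, hx3, hx4⟩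
      have h1 := hc.le_add_curve₂ h.curve₁ hx3.2 hx1
      have h2 := hb _ hx3.2 hx2
      exact ⟨hx3, by linarith, hx1, by linarith⟩
  · exact disjoint_left.2 fun x h1 h2 => absurd h1.2.2.1 (not_le.2 h2.1.2)
  · exact (measurable_snd measurableSet_Ico).inter (measurableSet_rightOf h.curve₁.continuousOn)

/-- No corner-shaped part of the central region carries more mass of `h` than the edges do. -/
lemma inner_cornerRegion_le (h : IsSolved f₁ f₂ s₁ s₂) (hc : IsCorner s₁ s₂ p c₁ c₂)
    (hp : ∫ x in region s₁ s₂ p, hFun f₁ f₂ x = f₁ 1 + f₂ 1) {b₁ b₂ : ℝ} (hb₁ : b₁ ∈ unitI)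
    (hb₂ : b₂ ∈ unitI) (hcb₁ : c₁ ≤ b₁) (hcb₂ : c₂ ≤ b₂) :
    innerMeasure f₁ f₂ (cornerRegion p b₁ b₂) ≤
      edgeMeasure (f₁ 1) f₂ (Ici b₂) + edgeMeasure (f₂ 1) f₁ (Ici b₁) := by
  have := h.isFinite_right
  have := h.isFinite_top
  by_cases h2 : s₂ b₁ ≤ b₂
  -- If `b` lies on or above the curve `s₂`, the whole corner set lies above that curve, so the top
  -- edge alone pays for it; the next case is the same for `s₁`.
  · refine le_add_left ?_
    rw [← h.inner_aboveOf measurableSet_Ici]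
    exact measure_mono fun x hx => ⟨hx.2.1, hx.1,
      (h.curve₂.antitone hb₁ hx.1.1 hx.2.1).trans (h2.trans hx.2.2.1)⟩
  by_cases h1 : s₁ b₂ ≤ b₁
  · refine le_add_right ?_
    rw [← h.inner_rightOf measurableSet_Ici]
    exact measure_mono fun x hx => ⟨hx.2.2.1, hx.1,
      (h.curve₁.antitone hb₂ hx.1.2 hx.2.2.1).trans (h1.trans hx.2.1)⟩
  rw [not_le] at h1 h2
  -- Now `b` is strictly below both curves. Shrinking the balanced set at `c` to the one at `b`, one
  -- coordinate at a time, removes at least the edge masses of `[c₁, b₁)` and `[c₂, b₂)`.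
  have e1 := h.inner_cornerRegion_add_le_fst hc hcb₁ (b₂ := b₂)
    fun x hx hxb => h2.le.trans (h.curve₂.antitone hx hb₁ hxb.le)
  have e2 := h.inner_cornerRegion_add_le_snd hc hcb₂ (b₁ := c₁)
    fun x hx hxb => hcb₁.trans (h1.le.trans (h.curve₁.antitone hx hb₂ hxb.le))
  rw [h.inner_cornerRegion hc hp] at e2
  have hfin : edgeMeasure (f₂ 1) f₁ (Ico c₁ b₁) + edgeMeasure (f₁ 1) f₂ (Ico c₂ b₂) ≠ ⊤ := by
    finiteness
  refine (ENNReal.add_le_add_iff_right hfin).1 ?_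
  calc _ = innerMeasure f₁ f₂ (cornerRegion p b₁ b₂) + edgeMeasure (f₂ 1) f₁ (Ico c₁ b₁)
        + edgeMeasure (f₁ 1) f₂ (Ico c₂ b₂) := (add_assoc _ _ _).symm
    _ ≤ _ := (add_le_add_left e1 _).trans e2
    _ = _ := by 
      rw [← measure_Ico_add_Ici _ hcb₁, ← measure_Ico_add_Ici (edgeMeasure (f₁ 1) f₂) hcb₂]
      ring

end IsSolved

/-! ### Stochastic dominance on the central part -/

lemma aemeasurable_innerMeasure {v : ℝ × ℝ → ℝ} (hv : ContinuousOn v square) (f₁ f₂ : ℝ → ℝ) :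
    AEMeasurable v (innerMeasure f₁ f₂) :=
  (hv.aemeasurable measurableSet_square).mono_ac (withDensity_absolutelyContinuous _ _)

lemma aemeasurable_edgeMeasure {v : ℝ → ℝ} (hv : ContinuousOn v unitI) (c : ℝ) (g : ℝ → ℝ) :
    AEMeasurable v (edgeMeasure c g) :=
  (hv.aemeasurable measurableSet_unitI).mono_ac (withDensity_absolutelyContinuous _ _)

lemma integrable_innerMeasure {v : ℝ × ℝ → ℝ} (hv : ContinuousOn v square) {f₁ f₂ : ℝ → ℝ}
    (hf₁ : IsDensity f₁) (hf₂ : IsDensity f₂) : Integrable v (innerMeasure f₁ f₂) := by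
  have := isFiniteMeasure_innerMeasure hf₁ hf₂
  obtain ⟨C, hC⟩ := isCompact_square.exists_bound_of_continuousOn hv
  refine Integrable.of_bound (aemeasurable_innerMeasure hv f₁ f₂).aestronglyMeasurable C ?_
  filter_upwards [ae_mem_square_innerMeasure f₁ f₂] with x hx using hC x hx

lemma integrable_edgeMeasure {v : ℝ → ℝ} (hv : ContinuousOn v unitI) {g : ℝ → ℝ}
    (hg : IsDensity g) (c : ℝ) : Integrable v (edgeMeasure c g) := by
  have := isFiniteMeasure_edgeMeasure hg c
  obtain ⟨C, hC⟩ := isCompact_unitI.exists_bound_of_continuousOn hv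
  refine Integrable.of_bound (aemeasurable_edgeMeasure hv c g).aestronglyMeasurable C ?_
  filter_upwards [ae_mem_unitI_edgeMeasure c g] with x hx using hC x hx

lemma _root_.ContinuousOn.rightEdge {v : ℝ × ℝ → ℝ} (hv : ContinuousOn v square) :
    ContinuousOn (fun y => v (1, y)) unitI :=
  hv.comp (by fun_prop) fun _ hy => ⟨one_mem_unitI, hy⟩

lemma _root_.ContinuousOn.topEdge {v : ℝ × ℝ → ℝ} (hv : ContinuousOn v square) :
    ContinuousOn (fun x => v (x, 1)) unitI :=
  hv.comp (by fun_prop) fun _ hx => ⟨hx, one_mem_unitI⟩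

/-- An upper set of an edge contains, up to a null set, the half-line from its infimum. -/
lemma edgeMeasure_Ici_sInf_le (c : ℝ) (g : ℝ → ℝ) {R : Set ℝ} (hR : R.Nonempty)
    (hbdd : BddBelow R) (hup : ∀ x ∈ R, ∀ y ∈ unitI, x ≤ y → y ∈ R) :
    edgeMeasure c g (Ici (sInf R)) ≤ edgeMeasure c g R := by
  rw [← measure_congr Ioi_ae_eq_Ici]
  refine measure_mono_ae ?_
  filter_upwards [ae_mem_unitI_edgeMeasure c g] with y hy hyR
  obtain ⟨x, hx, hxy⟩ := (csInf_lt_iff hbdd hR).1 hyR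
  exact hup x hx y hy hxy.le

namespace IsSolved

variable {f₁ f₂ s₁ s₂ : ℝ → ℝ} {p c₁ c₂ : ℝ}

/-- By monotonicity, pushing a point of the superlevel set to an edge stays in the superlevel set.
Hence the set lies in the corner set at the infima of the two edge traces, and the traces are upper
sets that fill the half-lines from these infima. -/
lemma inner_superlevel_le (h : IsSolved f₁ f₂ s₁ s₂) (hc : IsCorner s₁ s₂ p c₁ c₂)
    (hp : ∫ x in region s₁ s₂ p, hFun f₁ f₂ x = f₁ 1 + f₂ 1) {w : ℝ × ℝ → ℝ}
    (hw : MonotoneOn w square) (t : ℝ) :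
    innerMeasure f₁ f₂ ({x | t < w x} ∩ cornerRegion p c₁ c₂) ≤
      edgeMeasure (f₁ 1) f₂ ({y | t < w (1, y)} ∩ Ici c₂) +
        edgeMeasure (f₂ 1) f₁ ({x | t < w (x, 1)} ∩ Ici c₁) := by
  -- Nonemptiness ensures that the infima below are genuine and lie in the interval.
  rcases eq_empty_or_nonempty ({x | t < w x} ∩ cornerRegion p c₁ c₂) with hS | ⟨x₀, hx₀, hx₀'⟩
  · rw [hS, measure_empty]; exact zero_le
  set R : Set ℝ := {y | y ∈ unitI ∧ t < w (1, y) ∧ c₂ ≤ y} with hR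
  set T : Set ℝ := {x | x ∈ unitI ∧ t < w (x, 1) ∧ c₁ ≤ x} with hT
  have hSR : ∀ x ∈ {x | t < w x} ∩ cornerRegion p c₁ c₂, x.2 ∈ R ∧ x.1 ∈ T := by
    rintro x ⟨hx, hx1, hx2, hx3, -⟩
    refine ⟨⟨hx1.2, lt_of_lt_of_le hx (hw hx1 ⟨one_mem_unitI, hx1.2⟩ ⟨hx1.1.2, le_rfl⟩), hx3⟩,
      ⟨hx1.1, lt_of_lt_of_le hx (hw hx1 ⟨hx1.1, one_mem_unitI⟩ ⟨le_rfl, hx1.2.2⟩), hx2⟩⟩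
  have hRb : BddBelow R := ⟨c₂, fun y hy => hy.2.2⟩
  have hTb : BddBelow T := ⟨c₁, fun y hy => hy.2.2⟩
  obtain ⟨hR0, hT0⟩ := hSR x₀ ⟨hx₀, hx₀'⟩
  have hcR : c₂ ≤ sInf R := le_csInf ⟨_, hR0⟩ fun y hy => hy.2.2
  have hcT : c₁ ≤ sInf T := le_csInf ⟨_, hT0⟩ fun y hy => hy.2.2
  have hIR : sInf R ∈ unitI := ⟨hc.mem₂.1.trans hcR, (csInf_le hRb hR0).trans hR0.1.2⟩
  have hIT : sInf T ∈ unitI := ⟨hc.mem₁.1.trans hcT, (csInf_le hTb hT0).trans hT0.1.2⟩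
  calc _ ≤ innerMeasure f₁ f₂ (cornerRegion p (sInf T) (sInf R)) :=
        measure_mono fun x hx => ⟨hx.2.1, csInf_le hTb (hSR x hx).2, csInf_le hRb (hSR x hx).1,
          hx.2.2.2.2⟩
    _ ≤ _ := h.inner_cornerRegion_le hc hp hIT hIR hcT hcR
    _ ≤ _ := by
      refine add_le_add ?_ ?_
      · have hup : ∀ x ∈ R, ∀ y ∈ unitI, x ≤ y → y ∈ R := fun x hx y hy hxy =>
          ⟨hy, lt_of_lt_of_le hx.2.1 (hw (a := (1, x)) (b := (1, y)) ⟨one_mem_unitI, hx.1⟩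
            ⟨one_mem_unitI, hy⟩ ⟨le_rfl, hxy⟩), hx.2.2.trans hxy⟩
        have hsub : R ⊆ {y | t < w (1, y)} ∩ Ici c₂ := fun y hy => ⟨hy.2.1, hy.2.2⟩
        exact (edgeMeasure_Ici_sInf_le _ _ ⟨_, hR0⟩ hRb hup).trans (measure_mono hsub)
      · have hup : ∀ x ∈ T, ∀ y ∈ unitI, x ≤ y → y ∈ T := fun x hx y hy hxy =>
          ⟨hy, lt_of_lt_of_le hx.2.1 (hw (a := (x, 1)) (b := (y, 1)) ⟨hx.1, one_mem_unitI⟩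
            ⟨hy, one_mem_unitI⟩ ⟨hxy, le_rfl⟩), hx.2.2.trans hxy⟩
        have hsub : T ⊆ {y | t < w (y, 1)} ∩ Ici c₁ := fun y hy => ⟨hy.2.1, hy.2.2⟩
        exact (edgeMeasure_Ici_sInf_le _ _ ⟨_, hT0⟩ hTb hup).trans (measure_mono hsub)

/-- On the central region, the edge measures dominate the inner measure stochastically. -/
lemma integral_cornerRegion_le (h : IsSolved f₁ f₂ s₁ s₂) (hc : IsCorner s₁ s₂ p c₁ c₂)
    (hp : ∫ x in region s₁ s₂ p, hFun f₁ f₂ x = f₁ 1 + f₂ 1) {w : ℝ × ℝ → ℝ}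
    (hw : MonotoneOn w square) (hwc : ContinuousOn w square) (hw0 : ∀ x ∈ square, 0 ≤ w x) :
    ∫ x in cornerRegion p c₁ c₂, w x ∂(innerMeasure f₁ f₂) ≤
      ∫ y in Ici c₂, w (1, y) ∂(edgeMeasure (f₁ 1) f₂) +
        ∫ x in Ici c₁, w (x, 1) ∂(edgeMeasure (f₂ 1) f₁) := by
  have n1 : 0 ≤ᵐ[(innerMeasure f₁ f₂).restrict (cornerRegion p c₁ c₂)] w :=
    ae_restrict_of_ae ((ae_mem_square_innerMeasure f₁ f₂).mono hw0)
  have n2 : 0 ≤ᵐ[(edgeMeasure (f₁ 1) f₂).restrict (Ici c₂)] fun y => w (1, y) :=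
    ae_restrict_of_ae ((ae_mem_unitI_edgeMeasure _ _).mono fun y hy => hw0 _ ⟨one_mem_unitI, hy⟩)
  have n3 : 0 ≤ᵐ[(edgeMeasure (f₂ 1) f₁).restrict (Ici c₁)] fun x => w (x, 1) :=
    ae_restrict_of_ae ((ae_mem_unitI_edgeMeasure _ _).mono fun y hy => hw0 _ ⟨hy, one_mem_unitI⟩)
  have i1 := (integrable_innerMeasure hwc h.dens₁ h.dens₂).restrict (s := cornerRegion p c₁ c₂)
  have i2 := (integrable_edgeMeasure hwc.rightEdge h.dens₂ (f₁ 1)).restrict (s := Ici c₂)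
  have i3 := (integrable_edgeMeasure hwc.topEdge h.dens₁ (f₂ 1)).restrict (s := Ici c₁)
  have p2 := integral_nonneg_of_ae n2
  have p3 := integral_nonneg_of_ae n3
  -- The layer-cake formula reduces the claim to the comparison of superlevel sets.
  rw [← ENNReal.ofReal_le_ofReal_iff (add_nonneg p2 p3), ENNReal.ofReal_add p2 p3,
    ofReal_integral_eq_lintegral_ofReal i1 n1, ofReal_integral_eq_lintegral_ofReal i2 n2,
    ofReal_integral_eq_lintegral_ofReal i3 n3, lintegral_eq_lintegral_meas_lt _ n1 i1.aemeasurable,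
    lintegral_eq_lintegral_meas_lt _ n2 i2.aemeasurable,
    lintegral_eq_lintegral_meas_lt _ n3 i3.aemeasurable, ← lintegral_add_left]
  · refine lintegral_mono fun t => ?_
    simp only [Measure.restrict_apply' (measurableSet_cornerRegion p c₁ c₂),
      Measure.restrict_apply' measurableSet_Ici]
    exact h.inner_superlevel_le hc hp hw t
  · refine Antitone.measurable fun a b hab => measure_mono fun y hy => ?_
    exact lt_of_le_of_lt hab hy

end IsSolved

/-! ### The upper bound for the dual revenue -/

/-- Nonnegative continuous functions on the square that in each coordinate are nondecreasing with
slope at most one. -/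
structure HasUnitSlopes (v : ℝ × ℝ → ℝ) : Prop where
  nonneg : ∀ x ∈ square, 0 ≤ v x
  continuousOn : ContinuousOn v square
  mono₁ : ∀ y ∈ unitI, MonotoneOn (fun t => v (t, y)) unitI
  slope₁ : ∀ y ∈ unitI, MonotoneOn (fun t => t - v (t, y)) unitI
  mono₂ : ∀ x ∈ unitI, MonotoneOn (fun t => v (x, t)) unitI
  slope₂ : ∀ x ∈ unitI, MonotoneOn (fun t => t - v (x, t)) unitI

lemma HasUnitSlopes.monotoneOn_sub {v : ℝ × ℝ → ℝ} (hv : HasUnitSlopes v) :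
    MonotoneOn (fun x => x.1 + x.2 - v x) square := by
  rintro ⟨a, b⟩ ⟨ha, hb⟩ ⟨c, d⟩ ⟨hc, hd⟩ ⟨hac, hbd⟩
  have h1 := hv.slope₁ b hb ha hc hac
  have h2 := hv.slope₂ c hc hb hd hbd
  simp only at h1 h2 ⊢
  linarith

/-- The revenue functional after integration by parts. -/
noncomputable def dualRevenue (f₁ f₂ : ℝ → ℝ) (v : ℝ × ℝ → ℝ) : ℝ :=
  ∫ y, v (1, y) ∂(edgeMeasure (f₁ 1) f₂) + ∫ x, v (x, 1) ∂(edgeMeasure (f₂ 1) f₁) -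
    ∫ x, v x ∂(innerMeasure f₁ f₂)

lemma integral_Iio_add_Ici {μ : Measure ℝ} {g : ℝ → ℝ} (hg : Integrable g μ) (c : ℝ) :
    ∫ y in Iio c, g y ∂μ + ∫ y in Ici c, g y ∂μ = ∫ y, g y ∂μ := by
  rw [← compl_Iio]; exact integral_add_compl measurableSet_Iio hg

lemma integral_sub_add_const {α : Type*} [MeasurableSpace α] {μ : Measure α} [IsFiniteMeasure μ]
    {g v : α → ℝ} (hg : Integrable g μ) (hv : Integrable v μ) (k : ℝ) :
    ∫ x, (g x - v x + k) ∂μ = ∫ x, g x ∂μ - ∫ x, v x ∂μ + μ.real univ * k := by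
  have hgv : Integrable (fun x => g x - v x) μ := hg.sub hv
  rw [integral_add hgv (integrable_const k), integral_sub hg hv, integral_const, smul_eq_mul]

namespace IsSolved

variable {f₁ f₂ s₁ s₂ : ℝ → ℝ} {p c₁ c₂ : ℝ}

lemma integral_right (h : IsSolved f₁ f₂ s₁ s₂) (c : ℝ) {g : ℝ → ℝ} (hg : ContinuousOn g unitI) :
    ∫ y in Iio c, g y ∂(edgeMeasure (f₁ 1) f₂) =
      ∫ x in Prod.snd ⁻¹' Iio c ∩ rightOf s₁, g x.2 ∂(innerMeasure f₁ f₂) := by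
  have hmap := map_snd_innerMeasure_rightOf h.dens₁ h.dens₂ h.reg h.curve₁.mapsTo
    h.curve₁.continuousOn h.slice₁
  have hg' := (aemeasurable_edgeMeasure hg (f₁ 1) f₂).aestronglyMeasurable
  rw [← hmap] at hg' ⊢
  rw [setIntegral_map measurableSet_Iio hg' measurable_snd.aemeasurable,
    Measure.restrict_restrict (measurable_snd measurableSet_Iio)]

lemma integral_above (h : IsSolved f₁ f₂ s₁ s₂) (c : ℝ) {g : ℝ → ℝ} (hg : ContinuousOn g unitI) :
    ∫ y in Iio c, g y ∂(edgeMeasure (f₂ 1) f₁) =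
      ∫ x in Prod.fst ⁻¹' Iio c ∩ aboveOf s₂, g x.1 ∂(innerMeasure f₁ f₂) := by
  have hmap := map_fst_innerMeasure_aboveOf h.dens₁ h.dens₂ h.reg h.curve₂.mapsTo
    h.curve₂.continuousOn h.slice₂
  have hg' := (aemeasurable_edgeMeasure hg (f₂ 1) f₁).aestronglyMeasurable
  rw [← hmap] at hg' ⊢
  rw [setIntegral_map measurableSet_Iio hg' measurable_fst.aemeasurable,
    Measure.restrict_restrict (measurable_fst measurableSet_Iio)]

/-- The dual revenue, split along the parts of the region. -/
lemma dualRevenue_eq (h : IsSolved f₁ f₂ s₁ s₂) (hc : IsCorner s₁ s₂ p c₁ c₂) {v : ℝ × ℝ → ℝ}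
    (hv : ContinuousOn v square) :
    dualRevenue f₁ f₂ v =
      ∫ x in Prod.snd ⁻¹' Iio c₂ ∩ rightOf s₁, (v (1, x.2) - v x) ∂(innerMeasure f₁ f₂) +
      ∫ x in Prod.fst ⁻¹' Iio c₁ ∩ aboveOf s₂, (v (x.1, 1) - v x) ∂(innerMeasure f₁ f₂) +
      (∫ y in Ici c₂, v (1, y) ∂(edgeMeasure (f₁ 1) f₂) +
        ∫ x in Ici c₁, v (x, 1) ∂(edgeMeasure (f₂ 1) f₁) -
        ∫ x in cornerRegion p c₁ c₂, v x ∂(innerMeasure f₁ f₂)) -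
      ∫ x in (region s₁ s₂ p)ᶜ, v x ∂(innerMeasure f₁ f₂) := by
  have i0 := integrable_innerMeasure hv h.dens₁ h.dens₂
  have i1 : Integrable (fun x : ℝ × ℝ => v (1, x.2)) (innerMeasure f₁ f₂) :=
    integrable_innerMeasure (hv.rightEdge.comp continuousOn_snd fun _ hx => hx.2) h.dens₁ h.dens₂
  have i2 : Integrable (fun x : ℝ × ℝ => v (x.1, 1)) (innerMeasure f₁ f₂) :=
    integrable_innerMeasure (hv.topEdge.comp continuousOn_fst fun _ hx => hx.1) h.dens₁ h.dens₂
  rw [integral_sub i1.integrableOn i0.integrableOn, integral_sub i2.integrableOn i0.integrableOn,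
    ← h.integral_right c₂ hv.rightEdge, ← h.integral_above c₁ hv.topEdge, dualRevenue,
    ← integral_Iio_add_Ici (integrable_edgeMeasure hv.rightEdge h.dens₂ (f₁ 1)) c₂,
    ← integral_Iio_add_Ici (integrable_edgeMeasure hv.topEdge h.dens₁ (f₂ 1)) c₁,
    ← integral_add_compl (measurableSet_region h.curve₁ h.curve₂ p) i0]
  nth_rewrite 1 [h.region_decomposition hc]
  rw [setIntegral_union (h.disjoint_right_rest hc)
      ((h.measurableSet_above c₁).union (measurableSet_cornerRegion p c₁ c₂))
      i0.integrableOn i0.integrableOn,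
    setIntegral_union (disjoint_above_corner p c₁ c₂ s₂) (measurableSet_cornerRegion p c₁ c₂)
      i0.integrableOn i0.integrableOn]
  ring

/-- The central part of the dual revenue is largest for slopes one. -/
lemma central_le (h : IsSolved f₁ f₂ s₁ s₂) (hc : IsCorner s₁ s₂ p c₁ c₂)
    (hp : ∫ x in region s₁ s₂ p, hFun f₁ f₂ x = f₁ 1 + f₂ 1) {v : ℝ × ℝ → ℝ}
    (hv : HasUnitSlopes v) :
    ∫ y in Ici c₂, v (1, y) ∂(edgeMeasure (f₁ 1) f₂) +
        ∫ x in Ici c₁, v (x, 1) ∂(edgeMeasure (f₂ 1) f₁) -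
        ∫ x in cornerRegion p c₁ c₂, v x ∂(innerMeasure f₁ f₂) ≤
      ∫ y in Ici c₂, (1 + y - p) ∂(edgeMeasure (f₁ 1) f₂) +
        ∫ x in Ici c₁, (x + 1 - p) ∂(edgeMeasure (f₂ 1) f₁) -
        ∫ x in cornerRegion p c₁ c₂, (x.1 + x.2 - p) ∂(innerMeasure f₁ f₂) := by
  have := h.isFinite_inner
  have := h.isFinite_right
  have := h.isFinite_top
  have h0 : ((0 : ℝ), (0 : ℝ)) ∈ square := ⟨zero_mem_unitI, zero_mem_unitI⟩
  set ℓ : ℝ × ℝ → ℝ := fun x => x.1 + x.2 - p with hℓ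
  have hℓc : ContinuousOn ℓ square := by fun_prop
  set k : ℝ := p + v (0, 0) with hk
  have hmono := hv.monotoneOn_sub
  have hw : MonotoneOn (fun x => ℓ x - v x + k) square := fun x hx y hy hxy => by
    have := hmono hx hy hxy
    simp only [hℓ] at this ⊢
    linarith
  have hw0 : ∀ x ∈ square, 0 ≤ ℓ x - v x + k := fun x hx => by
    have := hmono h0 hx ⟨hx.1.1, hx.2.1⟩
    simp only [hℓ, hk] at this ⊢
    linarith
  have key := h.integral_cornerRegion_le hc hp hw ((hℓc.sub hv.continuousOn).add continuousOn_const)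
    hw0
  have a1 := (integrable_innerMeasure hℓc h.dens₁ h.dens₂).restrict (s := cornerRegion p c₁ c₂)
  have a2 := (integrable_innerMeasure hv.continuousOn h.dens₁ h.dens₂).restrict
    (s := cornerRegion p c₁ c₂)
  have b1 := (integrable_edgeMeasure hℓc.rightEdge h.dens₂ (f₁ 1)).restrict (s := Ici c₂)
  have b2 := (integrable_edgeMeasure hv.continuousOn.rightEdge h.dens₂ (f₁ 1)).restrict
    (s := Ici c₂)
  have d1 := (integrable_edgeMeasure hℓc.topEdge h.dens₁ (f₂ 1)).restrict (s := Ici c₁)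
  have d2 := (integrable_edgeMeasure hv.continuousOn.topEdge h.dens₁ (f₂ 1)).restrict
    (s := Ici c₁)
  rw [integral_sub_add_const a1 a2 k, integral_sub_add_const b1 b2 k,
    integral_sub_add_const d1 d2 k] at key
  simp only [measureReal_restrict_apply_univ] at key
  have hbal : (innerMeasure f₁ f₂).real (cornerRegion p c₁ c₂) =
      (edgeMeasure (f₁ 1) f₂).real (Ici c₂) + (edgeMeasure (f₂ 1) f₁).real (Ici c₁) := by
    rw [Measure.real, h.inner_cornerRegion hc hp, ENNReal.toReal_add (by finiteness) (by finiteness)]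
    rfl
  rw [hbal, add_mul] at key
  simp only [hℓ] at key ⊢
  linarith

/-- An upper bound for the dual revenue. -/
lemma dualRevenue_le (h : IsSolved f₁ f₂ s₁ s₂) (hc : IsCorner s₁ s₂ p c₁ c₂)
    (hp : ∫ x in region s₁ s₂ p, hFun f₁ f₂ x = f₁ 1 + f₂ 1) {v : ℝ × ℝ → ℝ}
    (hv : HasUnitSlopes v) :
    dualRevenue f₁ f₂ v ≤
      ∫ x in Prod.snd ⁻¹' Iio c₂ ∩ rightOf s₁, (1 - x.1) ∂(innerMeasure f₁ f₂) +
      ∫ x in Prod.fst ⁻¹' Iio c₁ ∩ aboveOf s₂, (1 - x.2) ∂(innerMeasure f₁ f₂) +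
      (∫ y in Ici c₂, (1 + y - p) ∂(edgeMeasure (f₁ 1) f₂) +
        ∫ x in Ici c₁, (x + 1 - p) ∂(edgeMeasure (f₂ 1) f₁) -
        ∫ x in cornerRegion p c₁ c₂, (x.1 + x.2 - p) ∂(innerMeasure f₁ f₂)) := by
  rw [h.dualRevenue_eq hc hv.continuousOn]
  have hvc := hv.continuousOn
  have i0 := integrable_innerMeasure hvc h.dens₁ h.dens₂
  have i1 : Integrable (fun x : ℝ × ℝ => v (1, x.2)) (innerMeasure f₁ f₂) :=
    integrable_innerMeasure (hvc.rightEdge.comp continuousOn_snd fun _ hx => hx.2) h.dens₁ h.dens₂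
  have i2 : Integrable (fun x : ℝ × ℝ => v (x.1, 1)) (innerMeasure f₁ f₂) :=
    integrable_innerMeasure (hvc.topEdge.comp continuousOn_fst fun _ hx => hx.1) h.dens₁ h.dens₂
  have i3 : Integrable (fun x : ℝ × ℝ => 1 - x.1) (innerMeasure f₁ f₂) :=
    integrable_innerMeasure (by fun_prop) h.dens₁ h.dens₂
  have i4 : Integrable (fun x : ℝ × ℝ => 1 - x.2) (innerMeasure f₁ f₂) :=
    integrable_innerMeasure (by fun_prop) h.dens₁ h.dens₂
  have e1 : ∫ x in Prod.snd ⁻¹' Iio c₂ ∩ rightOf s₁, (v (1, x.2) - v x) ∂(innerMeasure f₁ f₂) ≤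
      ∫ x in Prod.snd ⁻¹' Iio c₂ ∩ rightOf s₁, (1 - x.1) ∂(innerMeasure f₁ f₂) := by
    refine setIntegral_mono_on (i1.sub i0).integrableOn i3.integrableOn
      (h.measurableSet_right c₂) fun x hx => ?_
    have := hv.slope₁ x.2 hx.2.1.2 hx.2.1.1 one_mem_unitI hx.2.1.1.2
    simp only [Prod.mk.eta] at this
    linarith
  have e2 : ∫ x in Prod.fst ⁻¹' Iio c₁ ∩ aboveOf s₂, (v (x.1, 1) - v x) ∂(innerMeasure f₁ f₂) ≤
      ∫ x in Prod.fst ⁻¹' Iio c₁ ∩ aboveOf s₂, (1 - x.2) ∂(innerMeasure f₁ f₂) := by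
    refine setIntegral_mono_on (i2.sub i0).integrableOn i4.integrableOn
      (h.measurableSet_above c₁) fun x hx => ?_
    have := hv.slope₂ x.1 hx.2.1.1 hx.2.1.2 one_mem_unitI hx.2.1.2.2
    simp only [Prod.mk.eta] at this
    linarith
  have e3 : 0 ≤ ∫ x in (region s₁ s₂ p)ᶜ, v x ∂(innerMeasure f₁ f₂) :=
    integral_nonneg_of_ae (ae_restrict_of_ae ((ae_mem_square_innerMeasure f₁ f₂).mono hv.nonneg))
  linarith [h.central_le hc hp hv]

end IsSolved

/-! ### Values of `optUtility` on each part, and equality in the bound -/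

namespace IsCorner

variable {s₁ s₂ : ℝ → ℝ} {p c₁ c₂ : ℝ}

lemma optUtility_of_notMem_region {x : ℝ × ℝ} (hx : x ∈ square) (hr : x ∉ region s₁ s₂ p) :
    optUtility s₁ s₂ p x = 0 := by
  simp only [region, mem_ofPred_eq, not_and, not_or, not_le] at hr
  obtain ⟨h1, h2, h3⟩ := hr hx
  rw [optUtility, max_eq_left]
  exact max_le (by linarith) (max_le (by linarith) (by linarith))

lemma optUtility_of_corner (hc : IsCorner s₁ s₂ p c₁ c₂) (hs₁ : IsSlopeCurve s₁)
    (hs₂ : IsSlopeCurve s₂) {x : ℝ × ℝ} (hx : x ∈ square) (h₁ : c₁ ≤ x.1) (h₂ : c₂ ≤ x.2)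
    (hp : p ≤ x.1 + x.2) : optUtility s₁ s₂ p x = x.1 + x.2 - p := by
  have e1 := hc.le_add_curve₁ hs₂ hx.1 h₁
  have e2 := hc.le_add_curve₂ hs₁ hx.2 h₂
  rw [optUtility, max_eq_right (by linarith : x.2 - s₂ x.1 ≤ x.1 + x.2 - p),
    max_eq_right (by linarith : x.1 - s₁ x.2 ≤ x.1 + x.2 - p), max_eq_right (by linarith)]

lemma optUtility_of_right (hc : IsCorner s₁ s₂ p c₁ c₂) (hs₁ : IsSlopeCurve s₁)
    (hs₂ : IsSlopeCurve s₂) {x : ℝ × ℝ} (hx : x ∈ rightOf s₁) (h₂ : x.2 < c₂) :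
    optUtility s₁ s₂ p x = x.1 - s₁ x.2 := by
  have e1 := hc.le_add_curve₁ hs₂ hx.1.1 (hc.le_fst_of_mem_rightOf hs₁ hx h₂.le)
  have e2 := hc.lt₂ x.2 hx.1.2 h₂
  have e3 := hx.2
  rw [optUtility, max_eq_right (by linarith : x.2 - s₂ x.1 ≤ x.1 + x.2 - p),
    max_eq_left (by linarith : x.1 + x.2 - p ≤ x.1 - s₁ x.2), max_eq_right (by linarith)]

lemma optUtility_swap (s₁ s₂ : ℝ → ℝ) (p : ℝ) (x : ℝ × ℝ) :
    optUtility s₂ s₁ p x.swap = optUtility s₁ s₂ p x := by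
  simp only [optUtility, Prod.fst_swap, Prod.snd_swap, add_comm x.2]
  rw [max_left_comm (x.2 - s₂ x.1)]

lemma optUtility_of_above (hc : IsCorner s₁ s₂ p c₁ c₂) (hs₁ : IsSlopeCurve s₁)
    (hs₂ : IsSlopeCurve s₂) {x : ℝ × ℝ} (hx : x ∈ aboveOf s₂) (h₁ : x.1 < c₁) :
    optUtility s₁ s₂ p x = x.2 - s₂ x.1 := by
  rw [← optUtility_swap]
  exact hc.swap.optUtility_of_right hs₂ hs₁ (x := x.swap) ⟨⟨hx.1.2, hx.1.1⟩, hx.2⟩ h₁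

end IsCorner

namespace IsSolved

variable {f₁ f₂ s₁ s₂ : ℝ → ℝ} {p c₁ c₂ : ℝ}

/-- The upper bound for the dual revenue is attained. -/
lemma dualRevenue_optUtility (h : IsSolved f₁ f₂ s₁ s₂) (hc : IsCorner s₁ s₂ p c₁ c₂)
    (hu : ContinuousOn (optUtility s₁ s₂ p) square) :
    dualRevenue f₁ f₂ (optUtility s₁ s₂ p) =
      ∫ x in Prod.snd ⁻¹' Iio c₂ ∩ rightOf s₁, (1 - x.1) ∂(innerMeasure f₁ f₂) +
      ∫ x in Prod.fst ⁻¹' Iio c₁ ∩ aboveOf s₂, (1 - x.2) ∂(innerMeasure f₁ f₂) +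
      (∫ y in Ici c₂, (1 + y - p) ∂(edgeMeasure (f₁ 1) f₂) +
        ∫ x in Ici c₁, (x + 1 - p) ∂(edgeMeasure (f₂ 1) f₁) -
        ∫ x in cornerRegion p c₁ c₂, (x.1 + x.2 - p) ∂(innerMeasure f₁ f₂)) := by
  have e1 : ∫ x in Prod.snd ⁻¹' Iio c₂ ∩ rightOf s₁,
      (optUtility s₁ s₂ p (1, x.2) - optUtility s₁ s₂ p x) ∂(innerMeasure f₁ f₂) =
      ∫ x in Prod.snd ⁻¹' Iio c₂ ∩ rightOf s₁, (1 - x.1) ∂(innerMeasure f₁ f₂) := by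
    refine setIntegral_congr_fun (h.measurableSet_right c₂) fun x hx => ?_
    have h1 := hc.optUtility_of_right h.curve₁ h.curve₂ hx.2 hx.1
    have h2 := hc.optUtility_of_right h.curve₁ h.curve₂ (x := (1, x.2))
      ⟨⟨one_mem_unitI, hx.2.1.2⟩, (h.curve₁.mapsTo hx.2.1.2).2⟩ hx.1
    simp only [h1, h2]; ring
  have e2 : ∫ x in Prod.fst ⁻¹' Iio c₁ ∩ aboveOf s₂,
      (optUtility s₁ s₂ p (x.1, 1) - optUtility s₁ s₂ p x) ∂(innerMeasure f₁ f₂) =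
      ∫ x in Prod.fst ⁻¹' Iio c₁ ∩ aboveOf s₂, (1 - x.2) ∂(innerMeasure f₁ f₂) := by
    refine setIntegral_congr_fun (h.measurableSet_above c₁) fun x hx => ?_
    have h1 := hc.optUtility_of_above h.curve₁ h.curve₂ hx.2 hx.1
    have h2 := hc.optUtility_of_above h.curve₁ h.curve₂ (x := (x.1, 1))
      ⟨⟨hx.2.1.1, one_mem_unitI⟩, (h.curve₂.mapsTo hx.2.1.1).2⟩ hx.1
    simp only [h1, h2]; ring
  have e3 : ∫ x in cornerRegion p c₁ c₂, optUtility s₁ s₂ p x ∂(innerMeasure f₁ f₂) =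
      ∫ x in cornerRegion p c₁ c₂, (x.1 + x.2 - p) ∂(innerMeasure f₁ f₂) :=
    setIntegral_congr_fun (measurableSet_cornerRegion p c₁ c₂) fun x hx =>
      hc.optUtility_of_corner h.curve₁ h.curve₂ hx.1 hx.2.1 hx.2.2.1 hx.2.2.2
  have e4 : ∫ y in Ici c₂, optUtility s₁ s₂ p (1, y) ∂(edgeMeasure (f₁ 1) f₂) =
      ∫ y in Ici c₂, (1 + y - p) ∂(edgeMeasure (f₁ 1) f₂) := by
    refine integral_congr_ae ?_
    filter_upwards [ae_restrict_mem measurableSet_Ici,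
      ae_restrict_of_ae (ae_mem_unitI_edgeMeasure (f₁ 1) f₂)] with y hy hyI
    have h1 := hc.le_add_curve₂ h.curve₁ hyI hy
    exact hc.optUtility_of_corner h.curve₁ h.curve₂ ⟨one_mem_unitI, hyI⟩ hc.mem₁.2 hy
      (by linarith [(h.curve₁.mapsTo hyI).2])
  have e5 : ∫ x in Ici c₁, optUtility s₁ s₂ p (x, 1) ∂(edgeMeasure (f₂ 1) f₁) =
      ∫ x in Ici c₁, (x + 1 - p) ∂(edgeMeasure (f₂ 1) f₁) := by
    refine integral_congr_ae ?_
    filter_upwards [ae_restrict_mem measurableSet_Ici,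
      ae_restrict_of_ae (ae_mem_unitI_edgeMeasure (f₂ 1) f₁)] with y hy hyI
    have h1 := hc.le_add_curve₁ h.curve₂ hyI hy
    exact hc.optUtility_of_corner h.curve₁ h.curve₂ ⟨hyI, one_mem_unitI⟩ hy hc.mem₂.2
      (by linarith [(h.curve₂.mapsTo hyI).2])
  have e6 : ∫ x in (region s₁ s₂ p)ᶜ, optUtility s₁ s₂ p x ∂(innerMeasure f₁ f₂) = 0 := by
    refine integral_eq_zero_of_ae ?_
    filter_upwards [ae_restrict_mem (measurableSet_region h.curve₁ h.curve₂ p).compl,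
      ae_restrict_of_ae (ae_mem_square_innerMeasure f₁ f₂)] with x hx hxs
    exact IsCorner.optUtility_of_notMem_region hxs hx
  rw [h.dualRevenue_eq hc hu, e1, e2, e3, e4, e5, e6, sub_zero]

end IsSolved

/-! ### From derivative bounds almost everywhere to slope bounds everywhere -/

/-- A convex function on the unit interval has, in every open subinterval, points of
differentiability at which a given almost sure property holds. -/
lemma exists_differentiableAt_mem_Ioo {g : ℝ → ℝ} (hg : ConvexOn ℝ unitI g) {P : ℝ → Prop}
    (hP : ∀ᵐ t ∂(volume.restrict unitI), P t) {a b : ℝ} (ha : 0 ≤ a) (hb : b ≤ 1) (hab : a < b) :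
    ∃ t ∈ Ioo a b, DifferentiableAt ℝ g t ∧ P t := by
  have hsub : Ioo a b ⊆ unitI := fun x hx => ⟨ha.trans hx.1.le, hx.2.le.trans hb⟩
  -- Convex functions are locally Lipschitz on open intervals, so a small open set of positive
  -- measure consists almost entirely of points of differentiability. The derivative bound is
  -- informative only there, since `deriv` is zero elsewhere by convention.
  have hloc := (hg.subset hsub (convex_Ioo a b)).locallyLipschitzOn isOpen_Ioo
  obtain ⟨c, hc⟩ := exists_between hab
  obtain ⟨K, U, hU, hK⟩ := hloc (show c ∈ Ioo a b from hc)
  rw [isOpen_Ioo.nhdsWithin_eq hc] at hU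
  obtain ⟨V, hVU, hVo, hcV⟩ := mem_nhds_iff.1 (Filter.inter_mem hU (isOpen_Ioo.mem_nhds hc))
  have hpos : volume V ≠ 0 := (hVo.measure_pos volume ⟨c, hcV⟩).ne'
  have h1 := (hK.mono (hVU.trans inter_subset_left)).ae_differentiableWithinAt_real
    hVo.measurableSet
  have h2 : ∀ᵐ t ∂(volume.restrict V), P t :=
    ae_restrict_of_ae_restrict_of_subset (hVU.trans (inter_subset_right.trans hsub)) hP
  have hne : (ae (volume.restrict V)).NeBot := by
    rw [ae_neBot, Ne, Measure.restrict_eq_zero]; exact hpos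
  obtain ⟨t, h3, h4, h5⟩ := (h1.and (h2.and (ae_restrict_mem hVo.measurableSet))).exists
  exact ⟨t, (hVU h5).2, h3.differentiableAt (hVo.mem_nhds h5), h4⟩

section Convex

variable {g : ℝ → ℝ}

/-- At good points `t` arbitrarily close to the right of `x`, convexity bounds the slope from `t` to
`y` below by `g'(t) ≥ 0`; continuity at `x` then gives the claim. -/
lemma monotoneOn_of_convexOn_of_ae_deriv (hg : ConvexOn ℝ unitI g) (hgc : ContinuousOn g unitI)
    (h : ∀ᵐ t ∂(volume.restrict unitI), 0 ≤ deriv g t) : MonotoneOn g unitI := by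
  intro x hx y hy hxy
  rcases hxy.eq_or_lt with rfl | hlt
  · exact le_rfl
  have hcl : x ∈ closure {t | t ∈ Ioo x y ∧ g t ≤ g y} := by
    refine Metric.mem_closure_iff.2 fun ε hε => ?_
    obtain ⟨t, ht, hd, h0⟩ := exists_differentiableAt_mem_Ioo hg h hx.1
      (b := min y (x + ε)) (min_le_of_left_le hy.2) (lt_min hlt (by linarith))
    obtain ⟨h1, h2⟩ := lt_min_iff.1 ht.2
    have htI : t ∈ unitI := ⟨hx.1.trans ht.1.le, h1.le.trans hy.2⟩
    have h3 := h0.trans (hg.le_slope_of_hasDerivAt htI hy h1 hd.hasDerivAt)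
    rw [slope_def_field, le_div_iff₀ (by linarith)] at h3
    refine ⟨t, ⟨⟨ht.1, h1⟩, by linarith⟩, ?_⟩
    rw [dist_comm, Real.dist_eq, abs_of_pos (by linarith [ht.1])]
    linarith
  refine ContinuousWithinAt.closure_le hcl ?_ continuousWithinAt_const fun t ht => ht.2
  exact (hgc x hx).mono fun t ht => ⟨hx.1.trans ht.1.1.le, ht.1.2.le.trans hy.2⟩

/-- The mirror image: good points approach `y` from the left, and convexity bounds the slope from
`x` to `t` above by `g'(t) ≤ 1`. -/
lemma monotoneOn_sub_of_convexOn_of_ae_deriv (hg : ConvexOn ℝ unitI g)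
    (hgc : ContinuousOn g unitI) (h : ∀ᵐ t ∂(volume.restrict unitI), deriv g t ≤ 1) :
    MonotoneOn (fun t => t - g t) unitI := by
  intro x hx y hy hxy
  rcases hxy.eq_or_lt with rfl | hlt
  · exact le_rfl
  have hcl : y ∈ closure {t | t ∈ Ioo x y ∧ x - g x ≤ t - g t} := by
    refine Metric.mem_closure_iff.2 fun ε hε => ?_
    obtain ⟨t, ht, hd, h0⟩ := exists_differentiableAt_mem_Ioo hg h (a := max x (y - ε))
      (le_max_of_le_left hx.1) hy.2 (max_lt hlt (by linarith))
    obtain ⟨h1, h2⟩ := max_lt_iff.1 ht.1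
    have htI : t ∈ unitI := ⟨hx.1.trans h1.le, ht.2.le.trans hy.2⟩
    have h3 := (hg.slope_le_of_hasDerivAt hx htI h1 hd.hasDerivAt).trans h0
    rw [slope_def_field, div_le_iff₀ (by linarith)] at h3
    refine ⟨t, ⟨⟨h1, ht.2⟩, by linarith⟩, ?_⟩
    rw [Real.dist_eq, abs_of_pos (by linarith [ht.2])]
    linarith
  refine ContinuousWithinAt.closure_le hcl continuousWithinAt_const ?_ fun t ht => ht.2
  exact (continuousWithinAt_id.sub (hgc y hy)).mono
    fun t ht => ⟨hx.1.trans ht.1.1.le, ht.1.2.le.trans hy.2⟩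

end Convex

/-- An almost sure inequality between continuous functions holds everywhere. -/
lemma le_of_ae_le_unitI {g k : ℝ → ℝ} (hg : ContinuousOn g unitI) (hk : ContinuousOn k unitI)
    (h : ∀ᵐ t ∂(volume.restrict unitI), g t ≤ k t) {t : ℝ} (ht : t ∈ unitI) : g t ≤ k t := by
  have h1 := Measure.eqOn_Icc_of_ae_eq volume zero_ne_one
    (f := fun t => max (g t) (k t)) (g := k) (h.mono fun t ht => max_eq_right ht)
    (hg.sup hk) hk ht
  simpa using h1

lemma _root_.ContinuousOn.slice₁ {v : ℝ × ℝ → ℝ} (hv : ContinuousOn v square) {y : ℝ}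
    (hy : y ∈ unitI) : ContinuousOn (fun t => v (t, y)) unitI :=
  hv.comp (by fun_prop) fun _ ht => ⟨ht, hy⟩

lemma _root_.ContinuousOn.slice₂ {v : ℝ × ℝ → ℝ} (hv : ContinuousOn v square) {x : ℝ}
    (hx : x ∈ unitI) : ContinuousOn (fun t => v (x, t)) unitI :=
  hv.comp (by fun_prop) fun _ ht => ⟨hx, ht⟩

lemma _root_.ConvexOn.slice₁ {v : ℝ × ℝ → ℝ} (hv : ConvexOn ℝ square v) {y : ℝ}
    (hy : y ∈ unitI) : ConvexOn ℝ unitI (fun t => v (t, y)) := by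
  refine ⟨convex_unitI, fun a ha b hb r s hr hs hrs => ?_⟩
  have h := hv.2 (x := (a, y)) ⟨ha, hy⟩ (y := (b, y)) ⟨hb, hy⟩ hr hs hrs
  have e : r • (a, y) + s • (b, y) = (r • a + s • b, y) := by
    ext
    · rfl
    · simp only [Prod.smul_mk, Prod.mk_add_mk, ← add_smul, hrs, one_smul]
  rwa [e] at h

lemma swap_mem_square {x : ℝ × ℝ} : x.swap ∈ square ↔ x ∈ square := and_comm

lemma measurePreserving_swap_square :
    MeasurePreserving (Prod.swap : ℝ × ℝ → ℝ × ℝ) (volume.restrict square)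
      (volume.restrict square) := by
  rw [volume_restrict_square]; exact Measure.measurePreserving_swap

lemma setIntegral_square_swap (g : ℝ × ℝ → ℝ) :
    ∫ x in square, g x.swap = ∫ x in square, g x :=
  measurePreserving_swap_square.integral_comp MeasurableEquiv.prodComm.measurableEmbedding g

lemma partial₁_swap (u : ℝ × ℝ → ℝ) (x : ℝ × ℝ) :
    partial₁ (fun z => u z.swap) x.swap = partial₂ u x := rfl

lemma continuousOn_swap {u : ℝ × ℝ → ℝ} (hu : ContinuousOn u square) :
    ContinuousOn (fun z => u z.swap) square :=
  hu.comp continuous_swap.continuousOn fun _ hx => swap_mem_square.2 hx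

lemma IsFeasibleUtility.swap {u : ℝ × ℝ → ℝ} (hu : IsFeasibleUtility u) :
    IsFeasibleUtility (fun z => u z.swap) where
  nonneg _ hx := hu.nonneg _ (swap_mem_square.2 hx)
  continuousOn := continuousOn_swap hu.continuousOn
  convexOn := ⟨convex_square, fun x hx y hy _ _ ha hb hab =>
    hu.convexOn.2 (swap_mem_square.2 hx) (swap_mem_square.2 hy) ha hb hab⟩
  partials := by
    filter_upwards [measurePreserving_swap_square.quasiMeasurePreserving.ae hu.partials] with x hx
    exact ⟨hx.2, hx.1⟩

/-- Fubini gives the derivative bounds on almost every slice, convexity turns them into slope bounds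
there, and continuity in the other coordinate extends these to every slice. -/
lemma IsFeasibleUtility.slices₁ {u : ℝ × ℝ → ℝ} (hu : IsFeasibleUtility u) :
    (∀ y ∈ unitI, MonotoneOn (fun t => u (t, y)) unitI) ∧
      ∀ y ∈ unitI, MonotoneOn (fun t => t - u (t, y)) unitI := by
  have hp : ∀ᵐ y ∂(volume.restrict unitI), ∀ᵐ t ∂(volume.restrict unitI),
      deriv (fun r => u (r, y)) t ∈ Icc (0 : ℝ) 1 := by
    -- The swap makes the height `y` the outer variable in Fubini; the second partial of the swapped
    -- function is the first partial of `u`.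
    have h := hu.swap.partials
    rw [volume_restrict_square] at h
    exact (Measure.ae_ae_of_ae_prod h).mono fun y hy => hy.mono fun t ht => ht.2
  constructor
  · intro y hy a ha b hb hab
    refine le_of_ae_le_unitI (g := fun y => u (a, y)) (k := fun y => u (b, y))
      (hu.continuousOn.slice₂ ha) (hu.continuousOn.slice₂ hb) ?_ hy
    filter_upwards [hp, ae_restrict_mem measurableSet_unitI] with z hz hzI
    exact monotoneOn_of_convexOn_of_ae_deriv (hu.convexOn.slice₁ hzI) (hu.continuousOn.slice₁ hzI)
      (hz.mono fun t ht => ht.1) ha hb hab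
  · intro y hy a ha b hb hab
    refine le_of_ae_le_unitI (g := fun y => a - u (a, y)) (k := fun y => b - u (b, y))
      (continuousOn_const.sub (hu.continuousOn.slice₂ ha))
      (continuousOn_const.sub (hu.continuousOn.slice₂ hb)) ?_ hy
    filter_upwards [hp, ae_restrict_mem measurableSet_unitI] with z hz hzI
    exact monotoneOn_sub_of_convexOn_of_ae_deriv (hu.convexOn.slice₁ hzI)
      (hu.continuousOn.slice₁ hzI) (hz.mono fun t ht => ht.2) ha hb hab

lemma IsFeasibleUtility.hasUnitSlopes {u : ℝ × ℝ → ℝ} (hu : IsFeasibleUtility u) :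
    HasUnitSlopes u where
  nonneg := hu.nonneg
  continuousOn := hu.continuousOn
  mono₁ := hu.slices₁.1
  slope₁ := hu.slices₁.2
  mono₂ := hu.swap.slices₁.1
  slope₂ := hu.swap.slices₁.2

lemma lipschitzOnWith_of_monotoneOn {g : ℝ → ℝ} (h₁ : MonotoneOn g unitI)
    (h₂ : MonotoneOn (fun t => t - g t) unitI) : LipschitzOnWith 1 g unitI := by
  refine LipschitzOnWith.of_le_add_mul 1 fun x hx y hy => ?_
  rw [NNReal.coe_one, one_mul, Real.dist_eq]
  rcases le_total x y with h | h
  · linarith [h₁ hx hy h, abs_nonneg (x - y)]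
  · have := h₂ hy hx h
    simp only at this
    linarith [le_abs_self (x - y)]

/-- No differentiability is assumed: at points without a derivative the default value 0 lies in the
interval as well. -/
lemma deriv_mem_Icc_of_monotoneOn {g : ℝ → ℝ} (h₁ : MonotoneOn g unitI)
    (h₂ : MonotoneOn (fun t => t - g t) unitI) {t : ℝ} (ht : t ∈ Ioo (0 : ℝ) 1) :
    deriv g t ∈ Icc (0 : ℝ) 1 := by
  have hn : unitI ∈ nhds t := Icc_mem_nhds ht.1 ht.2
  constructor
  · rw [← derivWithin_of_mem_nhds hn]; exact h₁.derivWithin_nonneg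
  · have := norm_deriv_le_of_lipschitzOn hn (lipschitzOnWith_of_monotoneOn h₁ h₂)
    rw [NNReal.coe_one] at this
    exact (Real.le_norm_self _).trans this

lemma ae_mem_interior_square :
    ∀ᵐ x ∂((volume : Measure (ℝ × ℝ)).restrict square),
      x.1 ∈ Ioo (0 : ℝ) 1 ∧ x.2 ∈ Ioo (0 : ℝ) 1 := by
  rw [volume_restrict_square]
  exact (Measure.quasiMeasurePreserving_fst.ae ae_mem_Ioo).and
    (Measure.quasiMeasurePreserving_snd.ae ae_mem_Ioo)

namespace HasUnitSlopes

variable {v : ℝ × ℝ → ℝ}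

lemma swap (hv : HasUnitSlopes v) : HasUnitSlopes (fun z => v z.swap) where
  nonneg _ hx := hv.nonneg _ (swap_mem_square.2 hx)
  continuousOn := continuousOn_swap hv.continuousOn
  mono₁ := hv.mono₂
  slope₁ := hv.slope₂
  mono₂ := hv.mono₁
  slope₂ := hv.slope₁

lemma partial₁_mem (hv : HasUnitSlopes v) {x : ℝ × ℝ} (h₁ : x.1 ∈ Ioo (0 : ℝ) 1)
    (h₂ : x.2 ∈ Ioo (0 : ℝ) 1) : partial₁ v x ∈ Icc (0 : ℝ) 1 :=
  deriv_mem_Icc_of_monotoneOn (hv.mono₁ _ (Ioo_subset_Icc_self h₂))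
    (hv.slope₁ _ (Ioo_subset_Icc_self h₂)) h₁

lemma partial₂_mem (hv : HasUnitSlopes v) {x : ℝ × ℝ} (h₁ : x.1 ∈ Ioo (0 : ℝ) 1)
    (h₂ : x.2 ∈ Ioo (0 : ℝ) 1) : partial₂ v x ∈ Icc (0 : ℝ) 1 :=
  hv.swap.partial₁_mem (x := x.swap) h₂ h₁

lemma isFeasibleUtility (hv : HasUnitSlopes v) (hc : ConvexOn ℝ square v) :
    IsFeasibleUtility v where
  nonneg := hv.nonneg
  continuousOn := hv.continuousOn
  convexOn := hc
  partials := ae_mem_interior_square.mono fun _ hx =>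
    ⟨hv.partial₁_mem hx.1 hx.2, hv.partial₂_mem hx.1 hx.2⟩

lemma absCont₁ (hv : HasUnitSlopes v) {y : ℝ} (hy : y ∈ unitI) :
    AbsolutelyContinuousOnInterval (fun t => v (t, y)) 0 1 := by
  refine LipschitzOnWith.absolutelyContinuousOnInterval (K := 1) ?_
  rw [uIcc_zero_one]
  exact lipschitzOnWith_of_monotoneOn (hv.mono₁ y hy) (hv.slope₁ y hy)

end HasUnitSlopes

/-! ### Integration by parts for the revenue functional -/

/-- The partial derivative of a function that is continuous on the square is measurable there. -/
lemma aemeasurable_partial₁ {v : ℝ × ℝ → ℝ} (hv : ContinuousOn v square) :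
    AEMeasurable (partial₁ v) (volume.restrict square) := by
  -- Composing with the projection onto the interval extends `v` continuously to the plane without
  -- changing its partial derivatives in the open square.
  let π : ℝ → ℝ := fun t => projIcc 0 1 zero_le_one t
  have hπ : Continuous π := continuous_subtype_val.comp continuous_projIcc
  have hπI : ∀ t, π t ∈ unitI := fun t => (projIcc 0 1 zero_le_one t).2
  have hπe : ∀ t ∈ unitI, π t = t := fun t ht => by
    simp only [π, projIcc_of_mem zero_le_one ht]
  have hV : Continuous (fun z : ℝ × ℝ => v (π z.2, π z.1)) :=
    hv.comp_continuous ((hπ.comp continuous_snd).prodMk (hπ.comp continuous_fst))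
      fun z => ⟨hπI _, hπI _⟩
  have hm : Measurable (fun z : ℝ × ℝ => deriv (fun t => v (π t, π z.1)) z.2) :=
    measurable_deriv_with_param (f := fun y t => v (π t, π y)) hV
  refine ⟨fun x => deriv (fun t => v (π t, π x.2)) x.1, hm.comp measurable_swap, ?_⟩
  filter_upwards [ae_mem_interior_square] with x hx
  refine Filter.EventuallyEq.deriv_eq ?_
  filter_upwards [Icc_mem_nhds hx.1.1 hx.1.2] with t ht
  rw [hπe t ht, hπe x.2 (Ioo_subset_Icc_self hx.2)]

section Revenue

variable {f₁ f₂ : ℝ → ℝ} {v : ℝ × ℝ → ℝ}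

lemma integrable_mul_of_continuousOn (hv : ContinuousOn v square) {g : ℝ × ℝ → ℝ}
    (hg : IntegrableOn g square) : IntegrableOn (fun x => v x * g x) square := by
  obtain ⟨C, hC⟩ := isCompact_square.exists_bound_of_continuousOn hv
  refine Integrable.bdd_mul (c := C) hg (hv.aestronglyMeasurable measurableSet_square) ?_
  filter_upwards [ae_restrict_mem measurableSet_square] with x hx using hC x hx

lemma integrableOn_mul_prod {g k : ℝ → ℝ} (hg : IntegrableOn g unitI) (hk : IntegrableOn k unitI) :
    IntegrableOn (fun x : ℝ × ℝ => g x.1 * k x.2) square := by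
  rw [IntegrableOn, volume_restrict_square]; exact hg.mul_prod hk

lemma IsDensity.integrableOn_moment (hf₁ : IsDensity f₁) :
    IntegrableOn (fun t => t * f₁ t) unitI :=
  (continuousOn_id.mul hf₁.continuousOn).integrableOn_compact isCompact_unitI

lemma integrableOn_partial₁_mul (hf₁ : IsDensity f₁) (hf₂ : IsDensity f₂) (hv : HasUnitSlopes v) :
    IntegrableOn (fun x => partial₁ v x * (x.1 * f₁ x.1 * f₂ x.2)) square := by
  refine Integrable.bdd_mul (c := 1) (integrableOn_mul_prod hf₁.integrableOn_moment hf₂.integrableOn)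
    (aemeasurable_partial₁ hv.continuousOn).aestronglyMeasurable ?_
  filter_upwards [ae_mem_interior_square] with x hx
  have := hv.partial₁_mem hx.1 hx.2
  rw [Real.norm_eq_abs, abs_of_nonneg this.1]
  exact this.2

/-- Integration by parts in the first coordinate. -/
lemma integral_partial₁_mul (hf₁ : IsDensity f₁) (hf₂ : IsDensity f₂) (hv : HasUnitSlopes v) :
    ∫ x in square, partial₁ v x * (x.1 * f₁ x.1 * f₂ x.2) =
      ∫ y, v (1, y) ∂(edgeMeasure (f₁ 1) f₂) -
        ∫ x in square, v x * (momentDeriv f₁ x.1 * f₂ x.2) := by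
  have hi := integrable_mul_of_continuousOn hv.continuousOn
    (integrableOn_mul_prod hf₁.integrableOn_momentDeriv hf₂.integrableOn)
  have hj := integrableOn_partial₁_mul hf₁ hf₂ hv
  rw [integral_edgeMeasure hf₂ (hf₁.pos 1 one_mem_unitI).le, volume_restrict_square]
  rw [IntegrableOn, volume_restrict_square] at hi hj
  rw [integral_prod_symm _ hi, integral_prod_symm _ hj, ← integral_const_mul, ← integral_sub]
  · refine setIntegral_congr_fun measurableSet_unitI fun y hy => ?_
    have h := hf₁.integral_deriv_mul_moment (hv.absCont₁ hy)
    have e1 : ∫ x in unitI, partial₁ v (x, y) * (x * f₁ x * f₂ y) =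
        (∫ x in unitI, deriv (fun t => v (t, y)) x * (x * f₁ x)) * f₂ y := by
      rw [← integral_mul_const]
      refine integral_congr_ae (Filter.Eventually.of_forall fun x => ?_)
      simp only [partial₁]; ring
    have e2 : ∫ x in unitI, v (x, y) * (momentDeriv f₁ x * f₂ y) =
        (∫ x in unitI, v (x, y) * momentDeriv f₁ x) * f₂ y := by
      rw [← integral_mul_const]
      refine integral_congr_ae (Filter.Eventually.of_forall fun x => ?_)
      simp only; ring
    simp only [e1, e2, h]
    ring
  · exact ((hv.continuousOn.rightEdge.mul hf₂.continuousOn).integrableOn_compact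
      isCompact_unitI).const_mul _
  · exact hi.integral_prod_right

lemma integrableOn_partial₂_mul (hf₁ : IsDensity f₁) (hf₂ : IsDensity f₂) (hv : HasUnitSlopes v) :
    IntegrableOn (fun x => partial₂ v x * (x.2 * f₂ x.2 * f₁ x.1)) square :=
  measurePreserving_swap_square.integrable_comp_of_integrable
    (integrableOn_partial₁_mul hf₂ hf₁ hv.swap)

lemma integral_partial₂_mul (hf₁ : IsDensity f₁) (hf₂ : IsDensity f₂) (hv : HasUnitSlopes v) :
    ∫ x in square, partial₂ v x * (x.2 * f₂ x.2 * f₁ x.1) =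
      ∫ x, v (x, 1) ∂(edgeMeasure (f₂ 1) f₁) -
        ∫ x in square, v x * (f₁ x.1 * momentDeriv f₂ x.2) := by
  have h := integral_partial₁_mul hf₂ hf₁ hv.swap
  rw [← setIntegral_square_swap, ← setIntegral_square_swap (fun x => v x.swap * _)] at h
  simp only [partial₁_swap, Prod.swap_swap, Prod.fst_swap, Prod.snd_swap, Prod.swap_prod_mk] at h
  rw [h]
  simp only [mul_comm (f₁ _)]

/-- The revenue functional in terms of values instead of derivatives. -/
lemma revenueOf_eq_dualRevenue (hf₁ : IsDensity f₁) (hf₂ : IsDensity f₂) (hreg : IsRegular f₁ f₂)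
    (hv : HasUnitSlopes v) : revenueOf f₁ f₂ v = dualRevenue f₁ f₂ v := by
  have i1 := integrableOn_partial₁_mul hf₁ hf₂ hv
  have i2 := integrableOn_partial₂_mul hf₁ hf₂ hv
  have j1 := integrable_mul_of_continuousOn hv.continuousOn
    (integrableOn_mul_prod hf₁.integrableOn_momentDeriv hf₂.integrableOn)
  have j2 := integrable_mul_of_continuousOn hv.continuousOn
    (integrableOn_mul_prod hf₁.integrableOn hf₂.integrableOn_momentDeriv)
  have j3 := integrable_mul_of_continuousOn hv.continuousOn
    (integrableOn_mul_prod hf₁.integrableOn hf₂.integrableOn)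
  have e1 : revenueOf f₁ f₂ v =
      (∫ x in square, partial₁ v x * (x.1 * f₁ x.1 * f₂ x.2)) +
      (∫ x in square, partial₂ v x * (x.2 * f₂ x.2 * f₁ x.1)) -
      (∫ x in square, v x * (f₁ x.1 * f₂ x.2)) := by
    rw [← integral_add' i1 i2, ← integral_sub' (i1.add i2) j3, revenueOf]
    refine integral_congr_ae (Filter.Eventually.of_forall fun x => ?_)
    simp only [Pi.add_apply, Pi.sub_apply]; ring
  have e2 : ∫ x, v x ∂(innerMeasure f₁ f₂) =
      (∫ x in square, v x * (momentDeriv f₁ x.1 * f₂ x.2)) +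
      (∫ x in square, v x * (f₁ x.1 * momentDeriv f₂ x.2)) +
      (∫ x in square, v x * (f₁ x.1 * f₂ x.2)) := by
    rw [integral_innerMeasure hf₁ hf₂ hreg, ← integral_add' j1 j2, ← integral_add' (j1.add j2) j3]
    refine integral_congr_ae (Filter.Eventually.of_forall fun x => ?_)
    simp only [Pi.add_apply, hFun_eq]; ring
  rw [e1, dualRevenue, e2, integral_partial₁_mul hf₁ hf₂ hv, integral_partial₂_mul hf₁ hf₂ hv]
  ring

end Revenue

/-! ### Independence of values outside the square -/

section Congr

variable {u v : ℝ × ℝ → ℝ}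

lemma partials_congr (huv : EqOn u v square) {x : ℝ × ℝ} (h₁ : x.1 ∈ Ioo (0 : ℝ) 1)
    (h₂ : x.2 ∈ Ioo (0 : ℝ) 1) : partial₁ u x = partial₁ v x ∧ partial₂ u x = partial₂ v x := by
  constructor
  · refine Filter.EventuallyEq.deriv_eq ?_
    filter_upwards [Icc_mem_nhds h₁.1 h₁.2] with t ht
    exact huv ⟨ht, Ioo_subset_Icc_self h₂⟩
  · refine Filter.EventuallyEq.deriv_eq ?_
    filter_upwards [Icc_mem_nhds h₂.1 h₂.2] with t ht
    exact huv ⟨Ioo_subset_Icc_self h₁, ht⟩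

lemma revenueOf_congr (f₁ f₂ : ℝ → ℝ) (huv : EqOn u v square) :
    revenueOf f₁ f₂ u = revenueOf f₁ f₂ v := by
  refine integral_congr_ae ?_
  filter_upwards [ae_mem_interior_square, ae_restrict_mem measurableSet_square] with x hx hxs
  obtain ⟨h1, h2⟩ := partials_congr huv hx.1 hx.2
  rw [h1, h2, huv hxs]

lemma IsFeasibleUtility.congr (hu : IsFeasibleUtility u) (huv : EqOn u v square) :
    IsFeasibleUtility v where
  nonneg x hx := huv hx ▸ hu.nonneg x hx
  continuousOn := hu.continuousOn.congr fun _ hx => (huv hx).symm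
  convexOn := hu.convexOn.congr huv
  partials := by
    filter_upwards [hu.partials, ae_mem_interior_square] with x hx hxI
    obtain ⟨h1, h2⟩ := partials_congr huv hxI.1 hxI.2
    rwa [← h1, ← h2]

lemma IsOptimalUtility.congr {f₁ f₂ : ℝ → ℝ} (hu : IsOptimalUtility f₁ f₂ u)
    (huv : EqOn u v square) : IsOptimalUtility f₁ f₂ v :=
  ⟨hu.1.congr huv, fun w hw => (hu.2 w hw).trans_eq (revenueOf_congr f₁ f₂ huv)⟩

end Congr

/-! ### Subgradients of the candidate utility -/

section OptUtility

variable {s₁ s₂ : ℝ → ℝ} {p : ℝ}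

lemma optUtility_le_iff {x : ℝ × ℝ} {c : ℝ} : optUtility s₁ s₂ p x ≤ c ↔
    0 ≤ c ∧ x.1 - s₁ x.2 ≤ c ∧ x.2 - s₂ x.1 ≤ c ∧ x.1 + x.2 - p ≤ c := by
  simp only [optUtility, max_le_iff]

lemma le_optUtility (s₁ s₂ : ℝ → ℝ) (p : ℝ) (x : ℝ × ℝ) :
    0 ≤ optUtility s₁ s₂ p x ∧ x.1 - s₁ x.2 ≤ optUtility s₁ s₂ p x ∧
      x.2 - s₂ x.1 ≤ optUtility s₁ s₂ p x ∧ x.1 + x.2 - p ≤ optUtility s₁ s₂ p x :=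
  optUtility_le_iff.1 le_rfl

lemma optUtility_active (s₁ s₂ : ℝ → ℝ) (p : ℝ) (x : ℝ × ℝ) :
    optUtility s₁ s₂ p x = 0 ∨ optUtility s₁ s₂ p x = x.1 - s₁ x.2 ∨
      optUtility s₁ s₂ p x = x.2 - s₂ x.1 ∨ optUtility s₁ s₂ p x = x.1 + x.2 - p := by
  unfold optUtility
  rcases max_choice 0 (max (x.1 - s₁ x.2) (max (x.2 - s₂ x.1) (x.1 + x.2 - p))) with h | h
  · exact Or.inl h
  rcases max_choice (x.1 - s₁ x.2) (max (x.2 - s₂ x.1) (x.1 + x.2 - p)) with h' | h'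
  · exact Or.inr (Or.inl (h.trans h'))
  rcases max_choice (x.2 - s₂ x.1) (x.1 + x.2 - p) with h'' | h''
  · exact Or.inr (Or.inr (Or.inl (h.trans (h'.trans h''))))
  · exact Or.inr (Or.inr (Or.inr (h.trans (h'.trans h''))))

/-- Every point of the square has a supporting hyperplane with slopes in the unit interval. -/
lemma exists_subgradient_optUtility (hs₁ : IsSlopeCurve s₁) (hs₂ : IsSlopeCurve s₂)
    {b : ℝ × ℝ} (hb : b ∈ square) : ∃ a ∈ square, ∀ x ∈ square,
      optUtility s₁ s₂ p b + a.1 * (x.1 - b.1) + a.2 * (x.2 - b.2) ≤ optUtility s₁ s₂ p x := by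
  rcases optUtility_active s₁ s₂ p b with h | h | h | h
  · refine ⟨(0, 0), ⟨zero_mem_unitI, zero_mem_unitI⟩, fun x _ => ?_⟩
    simpa [h] using (le_optUtility s₁ s₂ p x).1
  -- A tangent line of slope `d` above `s₁` supports `x₁ - s₁(x₂)` from below with slopes `(1, -d)`;
  -- the bounds `-1 ≤ d ≤ 0` make `-d` an admissible allocation probability.
  · obtain ⟨d, hd1, hd0, hd⟩ := hs₁.exists_supergradient hb.2
    refine ⟨(1, -d), ⟨one_mem_unitI, by linarith, by linarith⟩, fun x hx => ?_⟩
    rw [h]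
    simp only
    linarith [hd x.2 hx.2, (le_optUtility s₁ s₂ p x).2.1]
  · obtain ⟨d, hd1, hd0, hd⟩ := hs₂.exists_supergradient hb.1
    refine ⟨(-d, 1), ⟨⟨by linarith, by linarith⟩, one_mem_unitI⟩, fun x hx => ?_⟩
    rw [h]
    simp only
    linarith [hd x.1 hx.1, (le_optUtility s₁ s₂ p x).2.2.1]
  · refine ⟨(1, 1), ⟨one_mem_unitI, one_mem_unitI⟩, fun x _ => ?_⟩
    rw [h]
    simp only
    linarith [(le_optUtility s₁ s₂ p x).2.2.2]

lemma optUtility_zero (hs₁ : IsSlopeCurve s₁) (hs₂ : IsSlopeCurve s₂) (hp : 0 ≤ p) :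
    optUtility s₁ s₂ p (0, 0) = 0 := by
  have h1 := (hs₁.mapsTo zero_mem_unitI).1
  have h2 := (hs₂.mapsTo zero_mem_unitI).1
  refine le_antisymm (optUtility_le_iff.2 ⟨le_rfl, ?_, ?_, ?_⟩) (le_optUtility s₁ s₂ p _).1 <;>
    simp only <;> linarith

end OptUtility

/-- `a` is a field of subgradients of `u` on the square with slopes in the unit interval. -/
structure IsSubgradientField (u : ℝ × ℝ → ℝ) (a : ℝ × ℝ → ℝ × ℝ) : Prop where
  mem : ∀ b ∈ square, a b ∈ square
  le : ∀ b ∈ square, ∀ x ∈ square, u b + (a b).1 * (x.1 - b.1) + (a b).2 * (x.2 - b.2) ≤ u x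

/-- Joint Lipschitz continuity is what Rademacher's theorem needs for differentiability almost
everywhere. -/
lemma lipschitzOnWith_square {u : ℝ × ℝ → ℝ}
    (h₁ : ∀ y ∈ unitI, LipschitzOnWith 1 (fun t => u (t, y)) unitI)
    (h₂ : ∀ x ∈ unitI, LipschitzOnWith 1 (fun t => u (x, t)) unitI) :
    LipschitzOnWith 2 u square := by
  refine LipschitzOnWith.of_dist_le_mul fun x hx y hy => ?_
  have e1 := (h₁ x.2 hx.2).dist_le_mul x.1 hx.1 y.1 hy.1
  have e2 := (h₂ y.1 hy.1).dist_le_mul x.2 hx.2 y.2 hy.2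
  simp only [NNReal.coe_one, one_mul, Prod.mk.eta] at e1 e2
  have e3 : dist x.1 y.1 ≤ dist x y := le_max_left _ _
  have e4 : dist x.2 y.2 ≤ dist x y := le_max_right _ _
  have e5 := dist_triangle (u x) (u (y.1, x.2)) (u y)
  push_cast
  linarith

namespace IsSubgradientField

variable {u : ℝ × ℝ → ℝ} {a : ℝ × ℝ → ℝ × ℝ}

lemma mono₁ (h : IsSubgradientField u a) {y : ℝ} (hy : y ∈ unitI) :
    MonotoneOn (fun t => u (t, y)) unitI := fun r hr t ht hrt => by
  have h1 := h.le (r, y) ⟨hr, hy⟩ (t, y) ⟨ht, hy⟩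
  have h2 := mul_nonneg (h.mem (r, y) ⟨hr, hy⟩).1.1 (sub_nonneg.2 hrt)
  simp only [sub_self, mul_zero] at h1 ⊢
  linarith

lemma slope₁ (h : IsSubgradientField u a) {y : ℝ} (hy : y ∈ unitI) :
    MonotoneOn (fun t => t - u (t, y)) unitI := fun r hr t ht hrt => by
  have h1 := h.le (t, y) ⟨ht, hy⟩ (r, y) ⟨hr, hy⟩
  have h2 := mul_le_of_le_one_left (sub_nonneg.2 hrt) (h.mem (t, y) ⟨ht, hy⟩).1.2
  simp only [sub_self, mul_zero] at h1 ⊢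
  linarith

lemma swap (h : IsSubgradientField u a) :
    IsSubgradientField (fun z => u z.swap) (fun z => (a z.swap).swap) where
  mem b hb := swap_mem_square.2 (h.mem _ (swap_mem_square.2 hb))
  le b hb x hx := by
    have := h.le _ (swap_mem_square.2 hb) _ (swap_mem_square.2 hx)
    simp only [Prod.fst_swap, Prod.snd_swap] at this ⊢
    linarith

lemma lipschitzOnWith (h : IsSubgradientField u a) : LipschitzOnWith 2 u square :=
  lipschitzOnWith_square (fun _ hy => lipschitzOnWith_of_monotoneOn (h.mono₁ hy) (h.slope₁ hy))
    fun _ hx => lipschitzOnWith_of_monotoneOn (h.swap.mono₁ hx) (h.swap.slope₁ hx)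

lemma hasUnitSlopes (h : IsSubgradientField u a) (h0 : ∀ x ∈ square, 0 ≤ u x) :
    HasUnitSlopes u where
  nonneg := h0
  continuousOn := h.lipschitzOnWith.continuousOn
  mono₁ _ hy := h.mono₁ hy
  slope₁ _ hy := h.slope₁ hy
  mono₂ _ hx := h.swap.mono₁ hx
  slope₂ _ hx := h.swap.slope₁ hx

lemma convexOn (h : IsSubgradientField u a) : ConvexOn ℝ square u := by
  refine ⟨convex_square, fun x hx y hy r s hr hs hrs => ?_⟩
  have hz := convex_square hx hy hr hs hrs
  have h1 := mul_le_mul_of_nonneg_left (h.le _ hz x hx) hr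
  have h2 := mul_le_mul_of_nonneg_left (h.le _ hz y hy) hs
  set z := r • x + s • y with hzd
  have e1 : z.1 = r * x.1 + s * y.1 := rfl
  have e2 : z.2 = r * x.2 + s * y.2 := rfl
  have key : r * (u z + (a z).1 * (x.1 - z.1) + (a z).2 * (x.2 - z.2)) +
      s * (u z + (a z).1 * (y.1 - z.1) + (a z).2 * (y.2 - z.2)) = u z := by
    rw [e1, e2]
    obtain rfl : s = 1 - r := by linarith
    ring
  simp only [smul_eq_mul]
  linarith

lemma isFeasibleUtility (h : IsSubgradientField u a) (h0 : ∀ x ∈ square, 0 ≤ u x) :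
    IsFeasibleUtility u :=
  (h.hasUnitSlopes h0).isFeasibleUtility h.convexOn

/-- By the subgradient inequality `u(t, x₂) - (a x).1 t` has a local minimum at `t = x₁`, so its
derivative vanishes there. -/
lemma partial₁_eq (h : IsSubgradientField u a) {x : ℝ × ℝ} (h₁ : x.1 ∈ Ioo (0 : ℝ) 1)
    (h₂ : x.2 ∈ Ioo (0 : ℝ) 1) (hd : DifferentiableAt ℝ u x) : partial₁ u x = (a x).1 := by
  have hxs : x ∈ square := ⟨Ioo_subset_Icc_self h₁, Ioo_subset_Icc_self h₂⟩
  have hd' : DifferentiableAt ℝ (fun t => u (t, x.2)) x.1 :=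
    DifferentiableAt.comp (g := u) x.1 hd (by fun_prop)
  have hg := hd'.hasDerivAt.sub ((hasDerivAt_id x.1).const_mul (a x).1)
  have hmin : IsLocalMin ((fun t => u (t, x.2)) - fun t => (a x).1 * id t) x.1 := by
    filter_upwards [Icc_mem_nhds h₁.1 h₁.2] with t ht
    have := h.le x hxs (t, x.2) ⟨ht, hxs.2⟩
    simp only [sub_self, mul_zero, Pi.sub_apply, id, Prod.mk.eta] at this ⊢
    linarith
  have := hmin.hasDerivAt_eq_zero hg
  simp only [partial₁]
  linarith

lemma ae_partials_eq (h : IsSubgradientField u a) :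
    ∀ᵐ x ∂(volume.restrict square), partial₁ u x = (a x).1 ∧ partial₂ u x = (a x).2 := by
  have hdiff := h.lipschitzOnWith.ae_differentiableWithinAt (μ := volume) measurableSet_square
  filter_upwards [hdiff, ae_mem_interior_square] with x hx hxI
  have hn : square ∈ nhds x := prod_mem_nhds (Icc_mem_nhds hxI.1.1 hxI.1.2)
    (Icc_mem_nhds hxI.2.1 hxI.2.2)
  have hd := hx.differentiableAt hn
  refine ⟨h.partial₁_eq hxI.1 hxI.2 hd, ?_⟩
  exact h.swap.partial₁_eq (x := x.swap) hxI.2 hxI.1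
    (DifferentiableAt.comp (g := u) x.swap hd (differentiableAt_snd.prodMk differentiableAt_fst))

end IsSubgradientField

/-! ### Mechanisms as subgradient fields -/

namespace Mechanism

/-- The utility of bid `b` is affine in the true value `x` with slopes the allocation at `b`, so
incentive compatibility is the subgradient inequality. -/
lemma IsAdmissible.isSubgradientField {M : Mechanism} (hM : M.IsAdmissible) :
    IsSubgradientField (fun x => M.utility x x) (fun x => (M.alloc₁ x, M.alloc₂ x)) where
  mem b hb := ⟨hM.alloc₁_mem b hb, hM.alloc₂_mem b hb⟩
  le b hb x hx := by
    have := hM.incentiveCompatible x hx b hb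
    simp only [utility] at this ⊢
    linarith

/-- The expected payment of a mechanism is the revenue functional at its utility function. -/
lemma IsAdmissible.expectedRevenue_eq {M : Mechanism} (hM : M.IsAdmissible) (f₁ f₂ : ℝ → ℝ) :
    M.expectedRevenue f₁ f₂ = revenueOf f₁ f₂ fun x => M.utility x x := by
  refine integral_congr_ae ?_
  filter_upwards [hM.isSubgradientField.ae_partials_eq] with x hx
  rw [hx.1, hx.2]
  simp only [utility]
  ring

lemma Induces.expectedRevenue_eq {M : Mechanism} {u : ℝ × ℝ → ℝ} (hM : M.Induces u)
    (f₁ f₂ : ℝ → ℝ) : M.expectedRevenue f₁ f₂ = revenueOf f₁ f₂ u :=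
  (hM.1.expectedRevenue_eq f₁ f₂).trans (revenueOf_congr f₁ f₂ hM.2)

lemma Induces.isOptimal {M : Mechanism} {u : ℝ × ℝ → ℝ} {f₁ f₂ : ℝ → ℝ} (hM : M.Induces u)
    (hu : IsOptimalUtility f₁ f₂ u) : M.IsOptimal f₁ f₂ := by
  refine ⟨hM.1, fun N hN => ?_⟩
  rw [hM.expectedRevenue_eq, hN.expectedRevenue_eq]
  exact hu.2 _ (hN.isSubgradientField.isFeasibleUtility hN.individuallyRational)

lemma exists_induces {u : ℝ × ℝ → ℝ} {a : ℝ × ℝ → ℝ × ℝ} (h : IsSubgradientField u a)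
    (h0 : ∀ x ∈ square, 0 ≤ u x) (hz : u (0, 0) = 0) : ∃ M : Mechanism, M.Induces u := by
  refine ⟨⟨fun x => (a x).1, fun x => (a x).2, fun x => (a x).1 * x.1 + (a x).2 * x.2 - u x⟩,
    ⟨fun b hb => (h.mem b hb).1, fun b hb => (h.mem b hb).2, fun b hb => ?_, fun x hx b hb => ?_,
      fun x hx => ?_⟩, fun x _ => ?_⟩
  -- Testing the subgradient inequality at the origin, where `u` vanishes, shows that the payment is
  -- nonnegative.
  · have := h.le b hb (0, 0) ⟨zero_mem_unitI, zero_mem_unitI⟩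
    simp only [hz] at this ⊢
    linarith
  · have := h.le b hb x hx
    simp only [utility]
    linarith
  · simpa [utility] using h0 x hx
  · simp [utility]

lemma fullBundling_induces {p : ℝ} (hp : 0 ≤ p) :
    (fullBundling p).Induces fun x => max 0 (x.1 + x.2 - p) := by
  have hu : ∀ x : ℝ × ℝ, (fullBundling p).utility x x = max 0 (x.1 + x.2 - p) := fun x => by
    by_cases h : p ≤ x.1 + x.2
    · rw [max_eq_right (by linarith)]
      simp [utility, fullBundling, h]
    · rw [max_eq_left (by linarith)]
      simp [utility, fullBundling, h]
  refine ⟨⟨fun b _ => ?_, fun b _ => ?_, fun b _ => ?_, fun x _ b _ => ?_, fun x _ => ?_⟩,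
    fun x _ => hu x⟩
  · by_cases h : p ≤ b.1 + b.2
    · simpa [fullBundling, h] using one_mem_unitI
    · simpa [fullBundling, h] using zero_mem_unitI
  · by_cases h : p ≤ b.1 + b.2
    · simpa [fullBundling, h] using one_mem_unitI
    · simpa [fullBundling, h] using zero_mem_unitI
  · by_cases h : p ≤ b.1 + b.2 <;> simp [fullBundling, h, hp]
  · rw [hu]
    by_cases h : p ≤ b.1 + b.2 <;> simp [utility, fullBundling, h]
  · rw [hu]; exact le_max_left _ _

end Mechanism

/-! ### Optimality of the candidate and the bundling case -/

lemma exists_isSubgradientField_optUtility {s₁ s₂ : ℝ → ℝ} (hs₁ : IsSlopeCurve s₁)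
    (hs₂ : IsSlopeCurve s₂) (p : ℝ) : ∃ a, IsSubgradientField (optUtility s₁ s₂ p) a := by
  choose! a ha using fun b (hb : b ∈ square) =>
    exists_subgradient_optUtility (p := p) hs₁ hs₂ hb
  exact ⟨a, fun b hb => (ha b hb).1, fun b hb => (ha b hb).2⟩

lemma IsSolved.isOptimalUtility {f₁ f₂ s₁ s₂ : ℝ → ℝ} {p c₁ c₂ : ℝ} (h : IsSolved f₁ f₂ s₁ s₂)
    (hc : IsCorner s₁ s₂ p c₁ c₂) (hp : ∫ x in region s₁ s₂ p, hFun f₁ f₂ x = f₁ 1 + f₂ 1) :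
    IsOptimalUtility f₁ f₂ (optUtility s₁ s₂ p) := by
  obtain ⟨a, ha⟩ := exists_isSubgradientField_optUtility h.curve₁ h.curve₂ p
  have hu := ha.isFeasibleUtility fun x _ => (le_optUtility s₁ s₂ p x).1
  refine ⟨hu, fun v hv => ?_⟩
  rw [revenueOf_eq_dualRevenue h.dens₁ h.dens₂ h.reg hu.hasUnitSlopes,
    revenueOf_eq_dualRevenue h.dens₁ h.dens₂ h.reg hv.hasUnitSlopes,
    h.dualRevenue_optUtility hc hu.continuousOn]
  exact h.dualRevenue_le hc hp hv.hasUnitSlopes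

/-- Since `t + sᵢ(t)` is nondecreasing, `p ≤ sᵢ(0)` gives `p ≤ t + sᵢ(t)` throughout, so the terms
of the single curves never exceed the bundle term. -/
lemma optUtility_eq_bundling {s₁ s₂ : ℝ → ℝ} {p : ℝ} (hs₁ : IsSlopeCurve s₁)
    (hs₂ : IsSlopeCurve s₂) (hp : p ≤ min (s₁ 0) (s₂ 0)) :
    EqOn (optUtility s₁ s₂ p) (fun x => max 0 (x.1 + x.2 - p)) square := by
  intro x hx
  obtain ⟨hp1, hp2⟩ := le_min_iff.1 hp
  have h1 := hs₁.sub_le_sub zero_mem_unitI hx.2 hx.2.1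
  have h2 := hs₂.sub_le_sub zero_mem_unitI hx.1 hx.1.1
  simp only [optUtility]
  rw [max_eq_right (by linarith : x.2 - s₂ x.1 ≤ x.1 + x.2 - p),
    max_eq_right (by linarith : x.1 - s₁ x.2 ≤ x.1 + x.2 - p)]

end TwoGood

theorem theorem1 (f₁ f₂ s₁ s₂ : ℝ → ℝ)
    (hf₁ : TwoGood.IsDensity f₁) (hf₂ : TwoGood.IsDensity f₂)
    (hreg : TwoGood.IsRegular f₁ f₂)
    (hs₁ : TwoGood.IsSlopeCurve s₁) (hs₂ : TwoGood.IsSlopeCurve s₂)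
    (hslice₁ : TwoGood.SolvesSlice f₁ f₂ s₁) (hslice₂ : TwoGood.SolvesSlice f₂ f₁ s₂) :
    ∃ p ∈ Set.Icc (0 : ℝ) 2,
      (∫ x in TwoGood.region s₁ s₂ p, TwoGood.hFun f₁ f₂ x) = f₁ 1 + f₂ 1 ∧
      TwoGood.IsOptimalUtility f₁ f₂ (TwoGood.optUtility s₁ s₂ p) ∧
      (∃ M : TwoGood.Mechanism, M.Induces (TwoGood.optUtility s₁ s₂ p)) ∧
      (∀ M : TwoGood.Mechanism, M.Induces (TwoGood.optUtility s₁ s₂ p) → M.IsOptimal f₁ f₂) ∧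
      (p ≤ min (s₁ 0) (s₂ 0) →
        TwoGood.IsOptimalUtility f₁ f₂ (fun x => max 0 (x.1 + x.2 - p)) ∧
        (TwoGood.Mechanism.fullBundling p).IsOptimal f₁ f₂) := by
  obtain ⟨p, hp, hbal, c₁, c₂, hc⟩ :=
    TwoGood.exists_balanced_price hf₁ hf₂ hreg hs₁ hs₂ hslice₁ hslice₂
  have hsol : TwoGood.IsSolved f₁ f₂ s₁ s₂ := ⟨hf₁, hf₂, hreg, hs₁, hs₂, hslice₁, hslice₂⟩
  have hopt := hsol.isOptimalUtility hc hbal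
  obtain ⟨a, ha⟩ := TwoGood.exists_isSubgradientField_optUtility hs₁ hs₂ p
  refine ⟨p, hp, hbal, hopt, ?_, fun M hM => hM.isOptimal hopt, fun hps => ?_⟩
  · exact TwoGood.Mechanism.exists_induces ha (fun x _ => (TwoGood.le_optUtility s₁ s₂ p x).1)
      (TwoGood.optUtility_zero hs₁ hs₂ hp.1)
  · have hb := hopt.congr (TwoGood.optUtility_eq_bundling hs₁ hs₂ hps)
    exact ⟨hb, (TwoGood.Mechanism.fullBundling_induces hp.1).isOptimal hb⟩
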